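/- Let $k$ be a field and $M$ a lattice (a finitely generated free abelian group), with dual lattice $N=\operatorname{Hom}(M,\mathbb Z)$ and $N_{\mathbb R}=\operatorname{Hom}(M,\mathbb R)$. For a submonoid $S\subseteq M$ with $\mathbb ZS=M$ let $S^{sat}=\{u\in M: nu\in S\text{ for some }n\ge 1\}$, and write $t^s\in k[S]$ for the element of the monoid algebra given by $s\in S$. For an ideal $I$ of a ring $R$, the blow-up is $\mathrm{Bl}_I(\operatorname{Spec}R)=\operatorname{Proj}\bigoplus_{n\ge0}I^n\to\operatorname{Spec}R$. (1) Let $S\subseteq M$ be a finitely generated submonoid with $\mathbb ZS=M$. Then the morphism $\operatorname{Spec}k[S^{sat}]\to\operatorname{Spec}k[S]$ given by $S\subseteq S^{sat}$ is the normalization of $\operatorname{Spec}k[S]$. There are finitely many generators $s_1,\dots,s_m$ of the monoid $S^{sat}$ and elements $s_i',s_i''\in S$ with $s_i=s_i'-s_i''$ for all $i$; and for every such choice, putting $$I=\prod_{i=1}^m\bigl(t^{s_i'},t^{s_i''}\bigr)\subseteq k[S],$$ there is an isomorphism $\operatorname{Spec}k[S^{sat}]\cong\mathrm{Bl}_I(\operatorname{Spec}k[S])$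 over $\operatorname{Spec}k[S]$. So the normalization of $\operatorname{Spec}k[S]$ is a blow-up. (2) A localization of a submonoid $S\subseteq M$ is a submonoid $S+\mathbb N(-u)$ with $u\in S$. Let $\Delta$ be a non-empty finite collection of finitely generated submonoids of $M$, each generating the group $M$, which is closed under localization and such that the sum of any two members is a localization of each of them. Let $X_\Delta$ be the (not necessarily normal) toric variety obtained by gluing the schemes $\operatorname{Spec}k[S]$, $S\in\Delta$, along the open subschemes $\operatorname{Spec}k[S+T]$. Then: - the collection of cones $\Sigma=\{(\mathbb R_{\ge0}S)^\vee : S\in\Delta\}$ is a fan in $N$, and the monoids $S_\sigma=\sigma^\vee\cap M$, $\sigma\in\Sigma$, form a collection of the same kind, which defines the normal toric variety $X_\Sigma$; - there is a morphism $\nu:X_\Sigma\to X_\Delta$ which is the normalization of $X_\Delta$ and which on the chart of $\sigma=(\mathbb R_{\ge0}S)^\vee$, $S\in\Delta$, is the morphism $\operatorname{Spec}k[S_\sigma]\to\operatorname{Spec}k[S]$ given by $S\subseteq S_\sigma$, followed by the chart $\operatorname{Spec}k[S]\to X_\Delta$; - over each chart $\operatorname{Spec}k[S]$ of $X_\Delta$,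 $S\in\Delta$, the normalization $\nu$ is a blow-up: for every choice of $s_i,s_i',s_i''$ for $S$ as in (1), the base change of $\nu$ to $\operatorname{Spec}k[S]$ is $\mathrm{Bl}_I(\operatorname{Spec}k[S])\to\operatorname{Spec}k[S]$ with $I=\prod_i(t^{s_i'},t^{s_i''})$. -/

import Mathlib

open CategoryTheory CategoryTheory.Limits AlgebraicGeometry Opposite

universe u

namespace ToricBlowup

/-! ### Submonoids of a lattice -/

section Monoids

variable {M : Type u} [AddCommGroup M]

/-- The saturation of a submonoid `S` of `M`: the elements of the group `ℤS` generated by `S`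
which have a positive multiple in `S`. -/
def saturation (S : AddSubmonoid M) : AddSubmonoid M where
  carrier := {x | x ∈ AddSubgroup.closure (S : Set M) ∧ ∃ n : ℕ, 0 < n ∧ n • x ∈ S}
  zero_mem' := ⟨zero_mem _, 1, one_pos, by simp⟩
  add_mem' := by
    rintro a b ⟨ha, n, hn, hna⟩ ⟨hb, m, hm, hmb⟩
    refine ⟨add_mem ha hb, n * m, Nat.mul_pos hn hm, ?_⟩
    have h1 : (n * m) • a ∈ S := by
      rw [mul_comm, mul_smul]; exact S.nsmul_mem hna m
    have h2 : (n * m) • b ∈ S := by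
      rw [mul_smul]; exact S.nsmul_mem hmb n
    rw [smul_add]
    exact S.add_mem h1 h2

theorem le_saturation (S : AddSubmonoid M) : S ≤ saturation S := fun x hx =>
  ⟨AddSubgroup.subset_closure hx, 1, one_pos, by simpa using hx⟩

/-- The localization `S + ℕ(-u)` of the monoid `S`, where `u` is meant to be an element of `S`. -/
def localizationAt (S : AddSubmonoid M) (u : M) : AddSubmonoid M :=
  S ⊔ AddSubmonoid.closure {-u}

/-- `T` is a localization of the monoid `S`. -/
def IsMonoidLocalization (S T : AddSubmonoid M) : Prop :=
  ∃ u ∈ S, T = localizationAt S u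

/-- The collections of monoids which define (not necessarily normal) toric varieties: non-empty
finite collections of finitely generated submonoids of `M`, each generating the group `M`, closed
under localization, such that the sum of any two members is a localization of each of them. -/
structure IsToricCollection (Δ : Set (AddSubmonoid M)) : Prop where
  nonempty : Δ.Nonempty
  finite : Δ.Finite
  fg : ∀ S ∈ Δ, S.FG
  generates : ∀ S ∈ Δ, AddSubgroup.closure (S : Set M) = ⊤
  localization_mem : ∀ S ∈ Δ, ∀ u ∈ S, localizationAt S u ∈ Δ
  sup_left : ∀ S ∈ Δ, ∀ T ∈ Δ, IsMonoidLocalization S (S ⊔ T)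
  sup_right : ∀ S ∈ Δ, ∀ T ∈ Δ, IsMonoidLocalization T (S ⊔ T)

end Monoids

/-! ### Toric varieties -/

noncomputable section Varieties

variable (k : Type u) [Field k] {M : Type u} [AddCommGroup M]

/-- The inclusion `k[S] → k[T]` of monoid algebras for `S ⊆ T`. -/
def algebraInclusion {S T : AddSubmonoid M} (h : S ≤ T) :
    AddMonoidAlgebra k S →+* AddMonoidAlgebra k T :=
  AddMonoidAlgebra.mapDomainRingHom k (AddSubmonoid.inclusion h)

theorem algebraInclusion_single {S T : AddSubmonoid M} (h : S ≤ T) (s : S) (c : k) :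
    algebraInclusion k h (AddMonoidAlgebra.single s c) =
      AddMonoidAlgebra.single (AddSubmonoid.inclusion h s) c := by
  simp [algebraInclusion]

/-- The affine scheme `Spec k[S]`. -/
abbrev affineToric (S : AddSubmonoid M) : Scheme.{u} :=
  Spec (CommRingCat.of (AddMonoidAlgebra k S))

/-- The morphism `Spec k[T] ⟶ Spec k[S]` given by the inclusion `S ⊆ T`. -/
def affineToricMap {S T : AddSubmonoid M} (h : S ≤ T) : affineToric k T ⟶ affineToric k S :=
  Spec.map (CommRingCat.ofHom (algebraInclusion k h))

theorem affineToricMap_comp {S T U : AddSubmonoid M} (h : S ≤ T) (h' : T ≤ U) :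
    affineToricMap k h' ≫ affineToricMap k h = affineToricMap k (h.trans h') := by
  simp only [affineToricMap]
  rw [← Spec.map_comp, ← CommRingCat.ofHom_comp]
  congr 2
  exact (AddMonoidAlgebra.mapDomainRingHom_comp (R := k) (AddSubmonoid.inclusion h')
    (AddSubmonoid.inclusion h)).symm

/-- If `T = S + ℕ(-u)` with `u ∈ S`, then `k[T]` is the localization of `k[S]` at `t^u`. -/
theorem isLocalization_algebraInclusion {S : AddSubmonoid M} {u : M} (hu : u ∈ S)
    {T : AddSubmonoid M} (h : S ≤ T) (hT : T = localizationAt S u) :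
    letI := (algebraInclusion k h).toAlgebra
    IsLocalization.Away (AddMonoidAlgebra.single (⟨u, hu⟩ : S) (1 : k))
      (AddMonoidAlgebra k T) := by
  let _ := (algebraInclusion k h).toAlgebra
  have hneg : -u ∈ T := by
    rw [hT]; exact AddSubmonoid.mem_sup_right (AddSubmonoid.subset_closure rfl)
  have halg : ∀ x, algebraMap (AddMonoidAlgebra k S) (AddMonoidAlgebra k T) x =
      algebraInclusion k h x := fun _ => rfl
  have hinj : Function.Injective (algebraInclusion k h) :=
    AddMonoidAlgebra.mapDomain_injective (AddSubmonoid.inclusion_injective h)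
  refine isLocalization_iff _ _ |>.mpr ⟨?_, ?_, ?_⟩
  · rintro ⟨_, n, rfl⟩
    simp only [map_pow]
    refine IsUnit.pow n (IsUnit.of_mul_eq_one (AddMonoidAlgebra.single ⟨-u, hneg⟩ 1) ?_)
    rw [halg, algebraInclusion_single, AddMonoidAlgebra.single_mul_single,
      AddMonoidAlgebra.one_def, mul_one]
    congr 1
    ext
    simp
  · intro z
    suffices ∃ (n : ℕ) (x : AddMonoidAlgebra k S),
        z * algebraInclusion k h (AddMonoidAlgebra.single (⟨u, hu⟩ : S) (1 : k) ^ n) =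
          algebraInclusion k h x by
      obtain ⟨n, x, hx⟩ := this
      exact ⟨(x, ⟨_, n, rfl⟩), hx⟩
    induction z using AddMonoidAlgebra.induction_linear with
    | zero => exact ⟨0, 0, by simp⟩
    | add f g hf hg =>
      obtain ⟨n, x, hx⟩ := hf
      obtain ⟨m, y, hy⟩ := hg
      refine ⟨n + m, x * AddMonoidAlgebra.single (⟨u, hu⟩ : S) (1 : k) ^ m +
        y * AddMonoidAlgebra.single (⟨u, hu⟩ : S) (1 : k) ^ n, ?_⟩
      rw [map_add, map_mul, map_mul, ← hx, ← hy, pow_add, map_mul]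
      ring
    | single t c =>
      obtain ⟨t, ht⟩ := t
      have ht' := ht
      rw [hT, localizationAt, AddSubmonoid.mem_sup] at ht'
      obtain ⟨s, hs, w, hw, rfl⟩ := ht'
      obtain ⟨n, rfl⟩ := AddSubmonoid.mem_closure_singleton.mp hw
      refine ⟨n, AddMonoidAlgebra.single ⟨s, hs⟩ c, ?_⟩
      rw [AddMonoidAlgebra.single_pow, algebraInclusion_single, algebraInclusion_single,
        AddMonoidAlgebra.single_mul_single]
      simp only [one_pow, mul_one]
      congr 1
      ext
      simp
  · intro x y hxy
    exact ⟨1, by rw [hinj hxy]⟩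

theorem isOpenImmersion_affineToricMap {S T : AddSubmonoid M} (h : S ≤ T)
    (hT : IsMonoidLocalization S T) : IsOpenImmersion (affineToricMap k h) := by
  obtain ⟨u, hu, hT⟩ := hT
  let _ := (algebraInclusion k h).toAlgebra
  have := isLocalization_algebraInclusion k hu h hT
  exact IsOpenImmersion.of_isLocalization (S := AddMonoidAlgebra k T)
    (AddMonoidAlgebra.single (⟨u, hu⟩ : S) (1 : k))

theorem range_affineToricMap {S T : AddSubmonoid M} (h : S ≤ T) {u : M} (hu : u ∈ S)
    (hT : T = localizationAt S u) :
    Set.range (affineToricMap k h) =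
      (PrimeSpectrum.basicOpen (AddMonoidAlgebra.single (⟨u, hu⟩ : S) (1 : k)) :
        Set (PrimeSpectrum (AddMonoidAlgebra k S))) := by
  let _ := (algebraInclusion k h).toAlgebra
  have := isLocalization_algebraInclusion k hu h hT
  exact PrimeSpectrum.localization_away_comap_range (AddMonoidAlgebra k T) _

variable (Δ : Set (AddSubmonoid M))

/-- The diagram of the charts `Spec k[S]`, `S ∈ Δ`, with a transition map
`Spec k[T] ⟶ Spec k[S]` whenever `S ⊆ T`. -/
def diagram : (↥Δ)ᵒᵖ ⥤ Scheme.{u} where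
  obj S := affineToric k S.unop.1
  map f := affineToricMap k (leOfHom f.unop)
  map_id S := by
    have : algebraInclusion k (le_refl S.unop.1) = RingHom.id _ := by
      apply AddMonoidAlgebra.mapDomainRingHom_id
    simp only [affineToricMap]
    erw [this]
    exact Spec.map_id _
  map_comp f g := (affineToricMap_comp k (leOfHom g.unop) (leOfHom f.unop)).symm

variable {Δ}

theorem isMonoidLocalization_of_le (hΔ : IsToricCollection Δ) {S T : AddSubmonoid M}
    (hS : S ∈ Δ) (hT : T ∈ Δ) (h : S ≤ T) : IsMonoidLocalization S T := by
  have := hΔ.sup_left S hS T hT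
  rwa [sup_eq_right.mpr h] at this

theorem isOpenImmersion_diagram_map (hΔ : IsToricCollection Δ) {S T : (↥Δ)ᵒᵖ} (f : S ⟶ T) :
    IsOpenImmersion ((diagram k Δ).map f) :=
  isOpenImmersion_affineToricMap k _
    (isMonoidLocalization_of_le hΔ T.unop.2 S.unop.2 (leOfHom f.unop))

theorem isLocallyDirected_diagram (hΔ : IsToricCollection Δ) :
    (diagram k Δ ⋙ Scheme.forget).IsLocallyDirected := by
  constructor
  intro A B C f g x y hxy
  obtain ⟨u, hu, hA⟩ := isMonoidLocalization_of_le hΔ C.unop.2 A.unop.2 (leOfHom f.unop)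
  obtain ⟨w, hw, hB⟩ := isMonoidLocalization_of_le hΔ C.unop.2 B.unop.2 (leOfHom g.unop)
  have huw : u + w ∈ C.unop.1 := add_mem hu hw
  have hle : C.unop.1 ≤ A.unop.1 ⊔ B.unop.1 := le_sup_of_le_left (leOfHom f.unop)
  have hD : A.unop.1 ⊔ B.unop.1 = localizationAt C.unop.1 (u + w) := by
    have hn : -(u + w) ∈ localizationAt C.unop.1 (u + w) :=
      AddSubmonoid.mem_sup_right (AddSubmonoid.subset_closure rfl)
    have hC : C.unop.1 ≤ localizationAt C.unop.1 (u + w) := le_sup_left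
    apply le_antisymm
    · refine sup_le ?_ ?_
      · rw [hA]
        refine sup_le hC ((AddSubmonoid.closure_le).mpr ?_)
        rintro _ rfl
        have := add_mem hn (hC hw)
        simpa using this
      · rw [hB]
        refine sup_le hC ((AddSubmonoid.closure_le).mpr ?_)
        rintro _ rfl
        have := add_mem hn (hC hu)
        simpa using this
    · refine sup_le hle ((AddSubmonoid.closure_le).mpr ?_)
      rintro _ rfl
      have h1 : -u ∈ A.unop.1 := by
        rw [hA]; exact AddSubmonoid.mem_sup_right (AddSubmonoid.subset_closure rfl)
      have h2 : -w ∈ B.unop.1 := by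
        rw [hB]; exact AddSubmonoid.mem_sup_right (AddSubmonoid.subset_closure rfl)
      have := add_mem (AddSubmonoid.mem_sup_left h1 : -u ∈ A.unop.1 ⊔ B.unop.1)
        (AddSubmonoid.mem_sup_right h2)
      change -(u + w) ∈ _
      rw [neg_add]
      exact this
  have hDmem : A.unop.1 ⊔ B.unop.1 ∈ Δ := by
    rw [hD]; exact hΔ.localization_mem _ C.unop.2 _ huw
  have hx : affineToricMap k (leOfHom f.unop) x ∈
      Set.range (affineToricMap k (leOfHom f.unop)) := ⟨x, rfl⟩
  have hy : affineToricMap k (leOfHom g.unop) y ∈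
      Set.range (affineToricMap k (leOfHom g.unop)) := ⟨y, rfl⟩
  have hxy' : affineToricMap k (leOfHom f.unop) x = affineToricMap k (leOfHom g.unop) y := hxy
  have hz : affineToricMap k (leOfHom f.unop) x ∈ Set.range (affineToricMap k hle) := by
    rw [range_affineToricMap k hle huw hD]
    have hx1 := hx
    have hy1 := hy
    rw [range_affineToricMap k _ hu hA] at hx1
    rw [← hxy', range_affineToricMap k _ hw hB] at hy1
    have hmul : (AddMonoidAlgebra.single (⟨u + w, huw⟩ : C.unop.1) (1 : k)) =
        AddMonoidAlgebra.single ⟨u, hu⟩ 1 * AddMonoidAlgebra.single ⟨w, hw⟩ 1 := by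
      rw [AddMonoidAlgebra.single_mul_single, mul_one]
      rfl
    rw [hmul, PrimeSpectrum.basicOpen_mul]
    exact ⟨hx1, hy1⟩
  obtain ⟨z, hz⟩ := hz
  have hAD : A.unop.1 ≤ A.unop.1 ⊔ B.unop.1 := le_sup_left
  have hBD : B.unop.1 ≤ A.unop.1 ⊔ B.unop.1 := le_sup_right
  have hf : IsOpenImmersion (affineToricMap k (leOfHom f.unop)) :=
    isOpenImmersion_diagram_map k hΔ f
  have hg : IsOpenImmersion (affineToricMap k (leOfHom g.unop)) :=
    isOpenImmersion_diagram_map k hΔ g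
  refine ⟨op ⟨_, hDmem⟩, (homOfLE (show A.unop ≤ ⟨_, hDmem⟩ from hAD)).op,
    (homOfLE (show B.unop ≤ ⟨_, hDmem⟩ from hBD)).op, z, ?_, ?_⟩
  · change affineToricMap k hAD z = x
    apply (affineToricMap k (leOfHom f.unop)).isOpenEmbedding.injective
    rw [← Scheme.Hom.comp_apply, affineToricMap_comp]
    exact hz
  · change affineToricMap k hBD z = y
    apply (affineToricMap k (leOfHom g.unop)).isOpenEmbedding.injective
    rw [← Scheme.Hom.comp_apply, affineToricMap_comp]
    exact hz.trans hxy'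

theorem hasColimit_diagram (hΔ : IsToricCollection Δ) : HasColimit (diagram k Δ) := by
  have := isLocallyDirected_diagram k hΔ
  have : ∀ {S T : (↥Δ)ᵒᵖ} (f : S ⟶ T), IsOpenImmersion ((diagram k Δ).map f) :=
    isOpenImmersion_diagram_map k hΔ
  infer_instance

/-- The toric variety `X_Δ`: the charts `Spec k[S]`, `S ∈ Δ`, glued along the open subschemes
`Spec k[S + T]`. (Every inclusion `S ⊆ T` in `Δ` is a localization, so the diagram consists of open
immersions, and `S + T ∈ Δ` for `S, T ∈ Δ`.) -/
def toricVariety (hΔ : IsToricCollection Δ) : Scheme.{u} :=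
  haveI := hasColimit_diagram k hΔ
  colimit (diagram k Δ)

/-- The chart `Spec k[S] ⟶ X_Δ`. -/
def chart (hΔ : IsToricCollection Δ) {S : AddSubmonoid M} (hS : S ∈ Δ) :
    affineToric k S ⟶ toricVariety k hΔ :=
  haveI := hasColimit_diagram k hΔ
  colimit.ι (diagram k Δ) (op ⟨S, hS⟩)

end Varieties

/-! ### Fans -/

section Fans

variable (M : Type u) [AddCommGroup M]

/-- For the lattice `N = Hom(M, ℤ)`, the real vector space `N_ℝ = Hom(M, ℝ)`. -/
abbrev NReal : Type u := M →ₗ[ℤ] ℝ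

variable {M}

/-- The inclusion of the lattice `N = Hom(M, ℤ)` in `N_ℝ`. -/
def latticeVector (v : M →ₗ[ℤ] ℤ) : NReal M := (Algebra.linearMap ℤ ℝ).comp v

/-- A strongly convex rational polyhedral cone in `N_ℝ`: the set of non-negative combinations of
finitely many vectors of `N`, containing no line. -/
def IsLatticeCone (σ : PointedCone ℝ (NReal M)) : Prop :=
  (∃ F : Set (M →ₗ[ℤ] ℤ), F.Finite ∧ σ = PointedCone.hull ℝ (latticeVector '' F)) ∧
    ∀ v ∈ σ, -v ∈ σ → v = 0

/-- `τ` is a face of `σ`, that is `τ = {v ∈ σ | ⟨u, v⟩ = 0}` for some `u ∈ M_ℝ` which is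
non-negative on `σ`; the vector space `M_ℝ` is the dual of `N_ℝ`, and `σ` is a face of itself. -/
def IsFace (τ σ : PointedCone ℝ (NReal M)) : Prop :=
  ∃ u : Module.Dual ℝ (NReal M), (∀ v ∈ σ, 0 ≤ u v) ∧ ∀ v, v ∈ τ ↔ v ∈ σ ∧ u v = 0

/-- A fan in `N`. -/
structure IsFan (F : Set (PointedCone ℝ (NReal M))) : Prop where
  finite : F.Finite
  cone : ∀ σ ∈ F, IsLatticeCone σ
  face_mem : ∀ σ ∈ F, ∀ τ, IsFace τ σ → τ ∈ F
  inf_left : ∀ σ ∈ F, ∀ τ ∈ F, IsFace (σ ⊓ τ) σ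
  inf_right : ∀ σ ∈ F, ∀ τ ∈ F, IsFace (σ ⊓ τ) τ

/-- The monoid `S_σ = σ^∨ ∩ M`. -/
def coneMonoid (σ : PointedCone ℝ (NReal M)) : AddSubmonoid M where
  carrier := {m | ∀ v ∈ σ, 0 ≤ v m}
  zero_mem' := by intro v _; simp
  add_mem' := by
    intro a b ha hb v hv
    rw [map_add]
    exact add_nonneg (ha v hv) (hb v hv)

/-- The cone `(ℝ_{≥0} S)^∨` in `N_ℝ`. -/
def dualCone (S : AddSubmonoid M) : PointedCone ℝ (NReal M) where
  carrier := {v | ∀ s ∈ S, 0 ≤ v s}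
  zero_mem' := by intro s _; simp
  add_mem' := by
    intro a b ha hb s hs
    exact add_nonneg (ha s hs) (hb s hs)
  smul_mem' := by
    intro c v hv s hs
    exact mul_nonneg c.2 (hv s hs)

end Fans

/-! ### Blow-ups of affine schemes -/

noncomputable section Blowup

variable {R : Type u} [CommRing R] (I : Ideal R)

/-- The degree `n` part `Iⁿ tⁿ` of the Rees algebra `⨁ₙ Iⁿ tⁿ ⊆ R[t]`. -/
def reesGrading (n : ℕ) : Submodule R (reesAlgebra I) :=
  (LinearMap.range (Polynomial.monomial n : R →ₗ[R] Polynomial R)).comap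
    (reesAlgebra I).val.toLinearMap

instance : SetLike.GradedMonoid (reesGrading I) where
  one_mem := ⟨1, by simp⟩
  mul_mem := by
    rintro i j x y ⟨a, ha⟩ ⟨b, hb⟩
    refine ⟨a * b, ?_⟩
    simp only [AlgHom.toLinearMap_apply, map_mul] at ha hb ⊢
    rw [← ha, ← hb, Polynomial.monomial_mul_monomial]

theorem isInternal_reesGrading : DirectSum.IsInternal (reesGrading I) := by
  classical
  have hcoeff : ∀ (n i : ℕ) (y : reesGrading I n),
      (((y : reesAlgebra I) : Polynomial R)).coeff i =
        if n = i then (((y : reesAlgebra I) : Polynomial R)).coeff n else 0 := by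
    rintro n i ⟨y, a, ha⟩
    change _ = (y : Polynomial R) at ha
    simp only [← ha, Polynomial.coeff_monomial, if_true]
  have hsum : ∀ (x : DirectSum ℕ fun n => reesGrading I n) (i : ℕ),
      ((DirectSum.coeAddMonoidHom (reesGrading I) x : reesAlgebra I) : Polynomial R).coeff i =
        ((x i : reesAlgebra I) : Polynomial R).coeff i := by
    intro x i
    induction x using DirectSum.induction_on with
    | zero => simp
    | of n y =>
      rw [DirectSum.coeAddMonoidHom_of, hcoeff]
      split_ifs with h
      · subst h; simp
      · rw [DirectSum.of_eq_of_ne _ _ _ (Ne.symm h)]; simp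
    | add x y hx hy =>
      rw [map_add, DirectSum.add_apply]
      simp only [Subalgebra.coe_add, Submodule.coe_add, Polynomial.coeff_add, hx, hy]
  constructor
  · intro x y hxy
    ext i j
    rw [hcoeff i j (x i), hcoeff i j (y i), ← hsum, ← hsum, hxy]
  · intro f
    have hf : ∀ i, Polynomial.monomial i ((f : Polynomial R).coeff i) ∈ reesAlgebra I :=
      fun i => reesAlgebra.monomial_mem.mpr (f.2 i)
    refine ⟨∑ i ∈ (f : Polynomial R).support,
      DirectSum.of (fun n => reesGrading I n) i ⟨⟨_, hf i⟩, ⟨_, rfl⟩⟩, ?_⟩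
    apply Subtype.ext
    rw [map_sum]
    simp only [DirectSum.coeAddMonoidHom_of, AddSubmonoidClass.coe_finsetSum]
    exact (Polynomial.as_sum_support (f : Polynomial R)).symm

instance : GradedAlgebra (reesGrading I) where
  __ := (isInternal_reesGrading I).chooseDecomposition

/-- The blow-up `Bl_I(Spec R) = Proj ⨁ₙ Iⁿ` of `Spec R` along the ideal `I`. -/
def blowup : Scheme.{u} := Proj (reesGrading I)

/-- The structure morphism `Bl_I(Spec R) ⟶ Spec R`. -/
def blowupMap : blowup I ⟶ Spec (CommRingCat.of R) :=
  Proj.toSpecZero (reesGrading I) ≫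
    Spec.map (CommRingCat.ofHom (algebraMap R (reesGrading I 0)))

end Blowup

/-! ### Normalization -/

noncomputable section Normalization

instance quasiCompact_fromSpecStalk_genericPoint (X : Scheme.{u}) [IsIntegral X] :
    QuasiCompact (X.fromSpecStalk (genericPoint X)) := by
  let _ : Field (X.presheaf.stalk (genericPoint X)) :=
    inferInstanceAs (Field X.functionField)
  have : Subsingleton (Spec (X.presheaf.stalk (genericPoint X))) :=
    inferInstanceAs (Subsingleton (PrimeSpectrum (X.presheaf.stalk (genericPoint X))))
  exact ⟨fun U _ _ => (Set.toFinite _).isCompact⟩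

/-- The normalization of an integral scheme `X`: its relative normalization in its generic point
`Spec K(X) ⟶ X`. -/
def normalization (X : Scheme.{u}) [IsIntegral X] : Scheme.{u} :=
  (X.fromSpecStalk (genericPoint X)).normalization

/-- The canonical morphism from the normalization of `X` to `X`. -/
def normalizationMap (X : Scheme.{u}) [IsIntegral X] : normalization X ⟶ X :=
  (X.fromSpecStalk (genericPoint X)).fromNormalization

/-- `X` is integral and `ν : Y ⟶ X` is (isomorphic over `X` to) the normalization of `X`. -/
def IsNormalization {X Y : Scheme.{u}} (ν : Y ⟶ X) : Prop :=
  ∃ (_ : IsIntegral X) (e : Y ≅ normalization X), e.hom ≫ normalizationMap X = ν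

end Normalization

/-! ### The ideals to be blown up -/

noncomputable section Ideals

variable (k : Type u) [Field k] {M : Type u} [AddCommGroup M]

/-- A choice of generators `s_i = s_i' - s_i''` of the saturation of `S` with `s_i', s_i'' ∈ S`. -/
structure IsGeneratingChoice (S : AddSubmonoid M) {m : ℕ} (s : Fin m → M) (s' s'' : Fin m → S) :
    Prop where
  eq_sub : ∀ i, s i = (s' i : M) - (s'' i : M)
  closure_eq : AddSubmonoid.closure (Set.range s) = saturation S

/-- The ideal `∏ᵢ (t^{s_i'}, t^{s_i''})` of `k[S]`. -/
def productIdeal {S : AddSubmonoid M} {m : ℕ} (s' s'' : Fin m → S) :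
    Ideal (AddMonoidAlgebra k S) :=
  ∏ i, Ideal.span {AddMonoidAlgebra.single (s' i) (1 : k), AddMonoidAlgebra.single (s'' i) (1 : k)}

end Ideals

end ToricBlowup

open ToricBlowup

/-! By Farkas' lemma over `ℚ` and clearing of denominators, the saturation of `S` consists of the
points of `M` on which the dual cone of `S` is non-negative (`coneMonoid_dualCone`). That cone has
finitely many lattice generators, so Gordan's lemma makes `S^sat` finitely generated. Monomials of
`S^sat` are integral over `k[S]`, and `k[S^sat]` is integrally closed: it is so in the Laurent
polynomial ring `k[M]`, because the lowest terms for a functional in the cone cannot cancel in an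
integral equation (`mem_range_of_isIntegralElem`). Both affine schemes contain the torus `Spec k[M]`
as an open subscheme, so an integral morphism with normal source is the normalization
(`isNormalization_of_isIntegralHom`).

For the blow-up, put `f = ∏ t^{s_i''}`. In `B = k[S^sat]` the ideal `I` becomes principal, generated
by `f`, since `t^{s_i'} = t^{s_i''} t^{s_i}`; and every element of `B` is `r / fⁿ` with `r ∈ Iⁿ`,
since the `s_i` generate. Hence the chart `D₊(f t)` of the Proj is `Spec B`. Integrality of `B` over
`k[S]` forces this chart to be the whole Proj: a homogeneous prime containing `f t` would contain
the irrelevant ideal (`exists_iso_blowup`).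

For a collection `Δ`, saturation commutes with localization and with sums, so the saturated monoids
form a collection of the same kind. Faces of dual cones correspond to localizations and
intersections to sums, which gives the fan. The affine normalizations glue, and the preimage of the
chart of `S` is exactly the chart of `S^sat` (`isPullback_chart_saturation`). Integrality and the
blow-up description are therefore read off chart by chart. -/

namespace ToricBlowup

/-! ### Rational cones: Farkas, duality with saturation, Gordan. -/

section Cones

/-- **Farkas' lemma** over an ordered field. -/
theorem farkas {K W : Type*} [Field K] [LinearOrder K] [IsStrictOrderedRing K] [AddCommGroup W]
    [Module K W] {n : ℕ} (a : Fin n → Module.Dual K W) (b : Module.Dual K W)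
    (h : ∀ x, (∀ i, 0 ≤ a i x) → 0 ≤ b x) :
    ∃ c : Fin n → K, (∀ i, 0 ≤ c i) ∧ b = ∑ i, c i • a i := by
  induction n generalizing b with
  | zero =>
    refine ⟨0, by simp, ?_⟩
    ext x
    have h1 := h x (by simp)
    have h2 := h (-x) (by simp)
    rw [map_neg] at h2
    simp only [Finset.univ_eq_empty, Finset.sum_empty, LinearMap.zero_apply]
    linarith
  | succ n ih =>
    by_cases hb : ∀ x, (∀ i : Fin n, 0 ≤ a i.castSucc x) → 0 ≤ b x
    · obtain ⟨c, hc, rfl⟩ := ih (fun i => a i.castSucc) b hb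
      refine ⟨Fin.snoc c 0, fun i => ?_, by simp [Fin.sum_univ_castSucc]⟩
      induction i using Fin.lastCases <;> simp [hc]
    · push Not at hb
      obtain ⟨y, hy, hby⟩ := hb
      have hay : a (Fin.last n) y < 0 := by
        by_contra! hcon
        refine absurd (h y fun i => ?_) (not_le.mpr hby)
        induction i using Fin.lastCases with
        | last => exact hcon
        | cast i => exact hy i
      -- Rescaling `y` to `t z = -1` makes `x ↦ x + t x • z` a projection onto the kernel of `t`.
      -- Composing the other forms with it eliminates `t` from the system.
      set t := a (Fin.last n)
      set z := (-(t y))⁻¹ • y with hz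
      have hpos : 0 < (-(t y))⁻¹ := inv_pos.mpr (by linarith)
      have htz : t z = -1 := by
        rw [hz, map_smul, smul_eq_mul, inv_neg, neg_mul, inv_mul_cancel₀ hay.ne]
      have hbz : b z < 0 := by
        rw [hz, map_smul, smul_eq_mul]; exact mul_neg_of_pos_of_neg hpos hby
      have haz : ∀ i : Fin n, 0 ≤ a i.castSucc z := fun i => by
        rw [hz, map_smul, smul_eq_mul]; exact mul_nonneg hpos.le (hy i)
      obtain ⟨c, hc, hcb⟩ := ih (fun i => a i.castSucc + a i.castSucc z • t) (b + b z • t) (by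
        intro x hx
        have := h (x + t x • z) fun i => by
          induction i using Fin.lastCases with
          | last => change 0 ≤ t _; simp [htz]
          | cast i => simpa [mul_comm] using hx i
        simpa [mul_comm] using this)
      -- Solving the projected identity for `b` gives this coefficient of `t`; it is non-negative
      -- because `b z < 0`.
      refine ⟨Fin.snoc c (∑ i, c i * a i.castSucc z - b z), fun i => ?_, ?_⟩
      · induction i using Fin.lastCases with
        | last =>
          simp only [Fin.snoc_last]
          have := Finset.sum_nonneg (s := Finset.univ) fun i _ => mul_nonneg (hc i) (haz i)
          linarith
        | cast i => simpa using hc i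
      · rw [Fin.sum_univ_castSucc]
        refine LinearMap.ext fun x => ?_
        have h1 := LinearMap.congr_fun hcb x
        simp only [LinearMap.add_apply, LinearMap.smul_apply, LinearMap.sum_apply, smul_eq_mul,
          mul_add, Finset.sum_add_distrib, ← mul_assoc, ← Finset.sum_mul, Fin.snoc_castSucc,
          Fin.snoc_last] at h1 ⊢
        change b x = _ + (_ - b z) * t x
        linear_combination h1

variable {M : Type u} [AddCommGroup M]

theorem mem_coneMonoid {σ : PointedCone ℝ (NReal M)} {m : M} :
    m ∈ coneMonoid σ ↔ ∀ v ∈ σ, 0 ≤ v m :=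
  Iff.rfl

theorem mem_dualCone_closure {F : Set M} {v : NReal M} :
    v ∈ dualCone (AddSubmonoid.closure F) ↔ ∀ s ∈ F, 0 ≤ v s := by
  refine ⟨fun h s hs => h s (AddSubmonoid.subset_closure hs), fun h s hs => ?_⟩
  induction hs using AddSubmonoid.closure_induction with
  | mem x hx => exact h x hx
  | zero => simp
  | add x y _ _ hx hy => rw [map_add]; exact add_nonneg hx hy

/-- Evaluation at an element of `M`, as a linear form on `N_ℝ`. -/
def evalForm (m : M) : Module.Dual ℝ (NReal M) where
  toFun v := v m
  map_add' _ _ := rfl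
  map_smul' _ _ := rfl

@[simp]
theorem evalForm_apply (m : M) (v : NReal M) : evalForm m v = v m := rfl

theorem dualCone_localizationAt {S : AddSubmonoid M} {u : M} (hu : u ∈ S) (v : NReal M) :
    v ∈ dualCone (localizationAt S u) ↔ v ∈ dualCone S ∧ v u = 0 := by
  constructor
  · intro h
    have h1 : v ∈ dualCone S := fun s hs => h s (AddSubmonoid.mem_sup_left hs)
    refine ⟨h1, le_antisymm ?_ (h1 u hu)⟩
    have := h (-u) (AddSubmonoid.mem_sup_right (AddSubmonoid.subset_closure rfl))
    rw [map_neg] at this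
    linarith
  · rintro ⟨h, hvu⟩ _ hx
    obtain ⟨s, hs, w, hw, rfl⟩ := AddSubmonoid.mem_sup.mp hx
    obtain ⟨n, rfl⟩ := AddSubmonoid.mem_closure_singleton.mp hw
    have := h s hs
    simpa [hvu] using this

/-- The step of the double description method: intersecting a finitely generated cone with a
half-space. -/
theorem hull_inter_halfspace (V : Set (M →ₗ[ℤ] ℤ)) (hV : V.Finite) (s : M) :
    ∃ V' : Set (M →ₗ[ℤ] ℤ), V'.Finite ∧
      ∀ v : NReal M, v ∈ PointedCone.hull ℝ (latticeVector '' V') ↔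
        v ∈ PointedCone.hull ℝ (latticeVector '' V) ∧ 0 ≤ v s := by
  set P := {v ∈ V | 0 ≤ v s} with hP
  set Q := {v ∈ V | v s < 0} with hQ
  have hPf : P.Finite := hV.subset fun v hv => hv.1
  have hQf : Q.Finite := hV.subset fun v hv => hv.1
  -- Keep the generators in the half-space. For each pair on opposite sides, add the positive
  -- combination lying on the hyperplane where `s` vanishes.
  set V' := P ∪ (fun p : (M →ₗ[ℤ] ℤ) × (M →ₗ[ℤ] ℤ) => p.1 s • p.2 - p.2 s • p.1) '' (P ×ˢ Q)
    with hV'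
  refine ⟨V', hPf.union ((hPf.prod hQf).image _), fun v => ⟨fun h => ?_, ?_⟩⟩
  · suffices hle : PointedCone.hull ℝ (latticeVector '' V') ≤
        PointedCone.hull ℝ (latticeVector '' V) ⊓ dualCone (AddSubmonoid.closure {s}) by
      have := hle h
      exact ⟨this.1, mem_dualCone_closure.mp this.2 s rfl⟩
    refine Submodule.span_le.mpr ?_
    rintro _ ⟨w, hw | ⟨⟨p, q⟩, ⟨hp, hq⟩, rfl⟩, rfl⟩
    · refine ⟨Submodule.subset_span ⟨w, hw.1, rfl⟩, mem_dualCone_closure.mpr ?_⟩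
      rintro _ rfl
      have := hw.2
      simpa [latticeVector] using this
    · have e : latticeVector (p s • q - q s • p) =
          (⟨(p s : ℝ), by exact_mod_cast hp.2⟩ : {c : ℝ // 0 ≤ c}) • latticeVector q +
          (⟨-(q s : ℝ), by have := hq.2; simp only [Left.nonneg_neg_iff]; exact_mod_cast this.le⟩ :
            {c : ℝ // 0 ≤ c}) • latticeVector p := by
        ext m
        change ((p s * q m - q s * p m : ℤ) : ℝ) = (p s : ℝ) * q m + -(q s : ℝ) * p m
        push_cast
        ring
      refine ⟨?_, mem_dualCone_closure.mpr ?_⟩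
      · simp only
        rw [e]
        exact add_mem (Submodule.smul_mem _ _ (Submodule.subset_span ⟨q, hq.1, rfl⟩))
          (Submodule.smul_mem _ _ (Submodule.subset_span ⟨p, hp.1, rfl⟩))
      · rintro _ rfl
        simp [latticeVector, mul_comm]
  · rintro ⟨h, hs⟩
    have hVPQ : latticeVector '' V = latticeVector '' P ∪ latticeVector '' Q := by
      rw [← Set.image_union]
      congr 1
      ext w
      simp only [hP, hQ, Set.mem_union, Set.mem_ofPred_eq, ← and_or_left]
      exact ⟨fun hw => ⟨hw, le_or_gt _ _⟩, fun hw => hw.1⟩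
    rw [PointedCone.hull, hVPQ, Submodule.span_union, Submodule.mem_sup] at h
    obtain ⟨p, hp, q, hq, rfl⟩ := h
    set D := PointedCone.hull ℝ (latticeVector '' V')
    have hsmul : ∀ (c : ℝ), 0 ≤ c → ∀ x ∈ D, c • x ∈ D := fun c hc x hx =>
      D.smul_mem hc hx
    have hpD : p ∈ D := Submodule.span_mono (Set.image_mono Set.subset_union_left) hp
    have hps : 0 ≤ p s := by
      clear hs hpD
      induction hp using Submodule.span_induction with
      | mem x hx =>
        obtain ⟨w, hw, rfl⟩ := hx
        have := hw.2
        simpa [latticeVector] using this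
      | zero => simp
      | add x y _ _ hx hy => exact add_nonneg hx hy
      | smul c x _ hx => exact mul_nonneg c.2 hx
    have hqs : q = 0 ∨ q s < 0 := by
      clear hs
      induction hq using Submodule.span_induction with
      | mem x hx =>
        obtain ⟨w, hw, rfl⟩ := hx
        have := hw.2
        right
        simpa [latticeVector] using this
      | zero => exact Or.inl rfl
      | add x y _ _ hx hy =>
        rcases hx with rfl | hx <;> rcases hy with rfl | hy
        · simp
        · simp [hy]
        · simp [hx]
        · exact Or.inr (add_neg hx hy)
      | smul c x _ hx =>
        rcases hx with rfl | hx
        · simp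
        · rcases c.2.eq_or_lt with h0 | h0
          · left
            have : c = 0 := Subtype.ext h0.symm
            simp [this]
          · exact Or.inr (mul_neg_of_pos_of_neg h0 hx)
    -- The expression is bilinear in `p` and `q`, so membership reduces to generators, where it is
    -- one of the new elements of `V'`.
    have hpq : p s • q - q s • p ∈ D := by
      clear hs hqs hps hpD
      induction hq using Submodule.span_induction with
      | zero => simp
      | add x y _ _ hx hy =>
        have := add_mem hx hy
        convert this using 1
        simp only [smul_add, LinearMap.add_apply, add_smul]
        abel
      | smul c x _ hx =>
        have := hsmul c c.2 _ hx
        convert this using 1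
        change p s • ((c : ℝ) • x) - ((c : ℝ) * x s) • p = _
        rw [smul_sub, smul_smul, smul_smul, smul_smul, mul_comm]
      | mem x hx =>
        obtain ⟨w, hw, rfl⟩ := hx
        induction hp using Submodule.span_induction with
        | zero => simp
        | add x y _ _ hx hy =>
          have := add_mem hx hy
          convert this using 1
          simp only [smul_add, LinearMap.add_apply, add_smul]
          abel
        | smul c x _ hx =>
          have := hsmul c c.2 _ hx
          convert this using 1
          change ((c : ℝ) * x s) • _ - _ • ((c : ℝ) • x) = _
          rw [smul_sub, smul_smul, smul_smul, smul_smul, mul_comm (c : ℝ) (latticeVector w s)]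
        | mem x hx =>
          obtain ⟨z, hz, rfl⟩ := hx
          refine Submodule.subset_span ⟨z s • w - w s • z, Or.inr ⟨(z, w), ⟨hz, hw⟩, rfl⟩, ?_⟩
          ext m
          simp [latticeVector]
    rcases hqs with rfl | hqs
    · simpa using hpD
    · have hps' : 0 < p s := by
        simp only [LinearMap.add_apply] at hs
        linarith
      -- Decomposition used: `p + q = (p s)⁻¹ (p s • q - q s • p) + ((p s + q s) / p s) • p`, with
      -- both coefficients non-negative.
      have h1 := hsmul (p s)⁻¹ (by positivity) _ hpq
      have h2 := hsmul ((p s + q s) / p s) (div_nonneg hs hps) _ hpD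
      convert add_mem h1 h2 using 1
      rw [smul_sub, smul_smul, smul_smul, inv_mul_cancel₀ hps'.ne', one_smul]
      have : (p s + q s) / p s = 1 + (p s)⁻¹ * q s := by field_simp
      rw [this, add_smul, one_smul]
      abel

theorem mem_saturation {S : AddSubmonoid M} (hS : AddSubgroup.closure (S : Set M) = ⊤) {m : M} :
    m ∈ saturation S ↔ ∃ n : ℕ, 0 < n ∧ n • m ∈ S := by
  change (_ ∧ _) ↔ _
  simp [hS]


/-- Farkas is applied over `ℚ` rather than `ℝ` so that the coefficients have a common denominator,
which becomes the multiple `n`. Freeness lets the resulting identity be checked on coordinates. -/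
theorem exists_nsmul_mem_of_forall_rat [Module.Free ℤ M] {F : Finset M} {m : M}
    (h : ∀ v : M →ₗ[ℤ] ℚ, (∀ s ∈ F, 0 ≤ v s) → 0 ≤ v m) :
    ∃ n : ℕ, 0 < n ∧ n • m ∈ AddSubmonoid.closure (F : Set M) := by
  classical
  let ev : M → Module.Dual ℚ (M →ₗ[ℤ] ℚ) := fun m =>
    { toFun := fun v => v m, map_add' := fun _ _ => rfl, map_smul' := fun _ _ => rfl }
  obtain ⟨c, hc, hm⟩ := farkas (fun i => ev (F.equivFin.symm i).1) (ev m) (by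
    intro v hv
    refine h v fun s hs => ?_
    have := hv (F.equivFin ⟨s, hs⟩)
    simpa [ev] using this)
  set N := ∏ i, (c i).den with hN
  have hNpos : 0 < N := Finset.prod_pos fun i _ => (c i).den_pos
  have hcN : ∀ i, ∃ k : ℕ, (k : ℚ) = N * c i := by
    intro i
    obtain ⟨q, hq⟩ : (c i).den ∣ N := Finset.dvd_prod_of_mem _ (Finset.mem_univ i)
    refine ⟨q * (c i).num.toNat, ?_⟩
    have h1 : (((c i).num.toNat : ℕ) : ℚ) = (c i).num := by
      exact_mod_cast Int.toNat_of_nonneg (Rat.num_nonneg.mpr (hc i))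
    rw [hq]
    push_cast
    rw [h1]
    have := Rat.mul_den_eq_num (c i)
    rw [← this]
    ring
  choose k hk using hcN
  refine ⟨N, hNpos, ?_⟩
  have : N • m = ∑ i, k i • (F.equivFin.symm i).1 := by
    let b := Module.Free.chooseBasis ℤ M
    refine b.ext_elem fun j => ?_
    have := LinearMap.congr_fun hm ((Algebra.linearMap ℤ ℚ).comp (b.coord j))
    simp only [ev, LinearMap.sum_apply, LinearMap.smul_apply] at this
    change ((b.repr m j : ℤ) : ℚ) = ∑ i, c i • ((b.repr (F.equivFin.symm i).1 j : ℤ) : ℚ) at this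
    have h2 : (((b.repr (N • m)) j : ℤ) : ℚ) =
        ((b.repr (∑ i, k i • (F.equivFin.symm i).1) j : ℤ) : ℚ) := by
      simp only [map_nsmul, map_sum, Finsupp.coe_finsetSum, Finset.sum_apply, Finsupp.smul_apply]
      push_cast
      simp only [nsmul_eq_mul]
      push_cast
      rw [this, Finset.mul_sum]
      refine Finset.sum_congr rfl fun i _ => ?_
      rw [smul_eq_mul, ← mul_assoc, hk]
    exact_mod_cast h2
  rw [this]
  exact sum_mem fun i _ => AddSubmonoid.nsmul_mem _
    (AddSubmonoid.subset_closure (F.equivFin.symm i).2) _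

/-- Rational functionals are in particular real ones, so non-negativity on the real dual cone
supplies the hypothesis of the rational Farkas argument. This identifies the monoids of the fan with
the saturations. -/
theorem coneMonoid_dualCone [Module.Free ℤ M] {S : AddSubmonoid M} (hfg : S.FG)
    (hS : AddSubgroup.closure (S : Set M) = ⊤) : coneMonoid (dualCone S) = saturation S := by
  ext m
  rw [mem_saturation hS, mem_coneMonoid]
  constructor
  · intro h
    obtain ⟨F, rfl⟩ := hfg
    refine exists_nsmul_mem_of_forall_rat fun v hv => ?_
    have := h ((Rat.castHom ℝ).toAddMonoidHom.toIntLinearMap.comp v) (mem_dualCone_closure.mpr (by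
      intro s hs
      simpa using hv s hs))
    simpa using this
  · rintro ⟨n, hn, h⟩ v hv
    have := hv _ h
    rw [map_nsmul, nsmul_eq_mul] at this
    exact nonneg_of_mul_nonneg_right this (by exact_mod_cast hn)

variable [Module.Free ℤ M] [Module.Finite ℤ M]

theorem exists_hull_eq_top :
    ∃ V : Set (M →ₗ[ℤ] ℤ), V.Finite ∧ PointedCone.hull ℝ (latticeVector '' V) = ⊤ := by
  let b := Module.Free.chooseBasis ℤ M
  refine ⟨Set.range b.coord ∪ Set.range (-b.coord), (Set.finite_range _).union
    (Set.finite_range _), ?_⟩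
  rw [eq_top_iff]
  rintro v -
  set D := PointedCone.hull ℝ (latticeVector '' (Set.range b.coord ∪ Set.range (-b.coord)))
  have hv : v = ∑ i, v (b i) • latticeVector (b.coord i) := by
    refine b.ext fun j => ?_
    simp [latticeVector, Finsupp.single_apply]
  rw [hv]
  refine sum_mem fun i _ => ?_
  rcases le_total 0 (v (b i)) with h | h
  · exact D.smul_mem h (Submodule.subset_span ⟨_, Or.inl ⟨i, rfl⟩, rfl⟩)
  · have := D.smul_mem (neg_nonneg.mpr h)
      (Submodule.subset_span ⟨_, Or.inr ⟨i, rfl⟩, rfl⟩)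
    convert this using 1
    ext m
    simp [latticeVector]

/-- The dual cone of a finitely generated monoid is generated by finitely many lattice vectors. -/
theorem exists_dualCone_eq_hull {S : AddSubmonoid M} (hS : S.FG) :
    ∃ V : Set (M →ₗ[ℤ] ℤ), V.Finite ∧ dualCone S = PointedCone.hull ℝ (latticeVector '' V) := by
  classical
  obtain ⟨F, rfl⟩ := hS
  induction F using Finset.induction_on with
  | empty =>
    obtain ⟨V, hV, h⟩ := exists_hull_eq_top (M := M)
    refine ⟨V, hV, ?_⟩
    rw [h, eq_top_iff]
    intro v _
    exact mem_dualCone_closure.mpr (by simp)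
  | insert s F _ ih =>
    obtain ⟨V, hV, h⟩ := ih
    obtain ⟨V', hV', h'⟩ := hull_inter_halfspace V hV s
    refine ⟨V', hV', ?_⟩
    ext v
    rw [h', ← h, mem_dualCone_closure, mem_dualCone_closure]
    simp [and_comm]

/-- **Gordan's lemma**. -/
theorem fg_of_finite_halfspaces {V : Set (M →ₗ[ℤ] ℤ)} (hV : V.Finite) {T : AddSubmonoid M}
    (hT : ∀ m, m ∈ T ↔ ∀ v ∈ V, 0 ≤ v m) : T.FG := by
  classical
  have := hV.to_subtype
  let b := Module.Free.chooseBasis ℤ M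
  let ι := Module.Free.ChooseBasisIndex ℤ M
  -- Elements of `T` are encoded by natural numbers: positive parts of the coordinates, negative
  -- parts, and the values of the forms in `V`. The constraint is an equality of two homomorphisms
  -- out of `A`; its solution monoid is finitely generated and maps onto `T`.
  let A := (ι → ℕ) × (ι → ℕ) × (V → ℕ)
  let lin : (ι → ℕ) →+ M :=
    { toFun := fun p => ∑ i, p i • b i
      map_zero' := by simp
      map_add' := fun p q => by simp [add_smul, Finset.sum_add_distrib] }
  let proj : A →+ M := lin.comp (AddMonoidHom.fst _ _) -
    lin.comp ((AddMonoidHom.fst _ _).comp (AddMonoidHom.snd _ _))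
  let f : A →+ (V → ℤ) := AddMonoidHom.pi fun v => v.1.toAddMonoidHom.comp proj
  let g : A →+ (V → ℤ) := AddMonoidHom.pi fun v => (Nat.castAddMonoidHom ℤ).comp
    ((Pi.evalAddMonoidHom _ v).comp ((AddMonoidHom.snd _ _).comp (AddMonoidHom.snd _ _)))
  have hfg : (f.eqLocusM g).FG := AddSubmonoid.fg_eqLocusM f g
  convert hfg.map proj
  ext m
  rw [hT, AddSubmonoid.mem_map]
  constructor
  · intro h
    refine ⟨(fun i => (b.repr m i).toNat, fun i => (-b.repr m i).toNat,
      fun v => (v.1 m).toNat), ?_, ?_⟩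
    all_goals
      have hm : proj (fun i => (b.repr m i).toNat, fun i => (-b.repr m i).toNat,
          fun v => (v.1 m).toNat) = m := by
        simp only [proj, lin, AddMonoidHom.sub_apply, AddMonoidHom.comp_apply,
          AddMonoidHom.coe_mk, ZeroHom.coe_mk]
        rw [← Finset.sum_sub_distrib]
        conv_rhs => rw [← b.sum_repr m]
        refine Finset.sum_congr rfl fun i _ => ?_
        rw [← natCast_zsmul, ← natCast_zsmul, ← sub_smul]
        congr 1
        exact Int.toNat_sub_toNat_neg _
    · funext v
      change v.1 (proj _) = ((v.1 m).toNat : ℤ)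
      rw [hm, Int.toNat_of_nonneg (h v.1 v.2)]
    · exact hm
  · rintro ⟨x, hx, rfl⟩ v hv
    have := congr_fun hx ⟨v, hv⟩
    change v (proj x) = ((x.2.2 ⟨v, hv⟩ : ℕ) : ℤ) at this
    rw [this]
    positivity

/-- The finitely many lattice generators of the dual cone already cut out the saturation, so
Gordan's lemma applies. -/
theorem saturation_fg {S : AddSubmonoid M} (hfg : S.FG)
    (hS : AddSubgroup.closure (S : Set M) = ⊤) : (saturation S).FG := by
  obtain ⟨V, hV, h⟩ := exists_dualCone_eq_hull hfg
  refine fg_of_finite_halfspaces hV fun m => ?_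
  rw [← coneMonoid_dualCone hfg hS, mem_coneMonoid, h]
  constructor
  · intro hm v hv
    have := hm _ (Submodule.subset_span ⟨v, hv, rfl⟩)
    simpa [latticeVector] using this
  · intro hm v hv
    induction hv using Submodule.span_induction with
    | mem x hx =>
      obtain ⟨w, hw, rfl⟩ := hx
      have := hm w hw
      simpa [latticeVector] using this
    | zero => simp
    | add x y _ _ hx hy => exact add_nonneg hx hy
    | smul c x _ hx => exact mul_nonneg c.2 hx

end Cones

/-! ### Localization, saturation and the fan of a toric collection. -/

section Monoids

variable {M : Type u} [AddCommGroup M]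

theorem le_localizationAt (S : AddSubmonoid M) (u : M) : S ≤ localizationAt S u := le_sup_left

theorem neg_mem_localizationAt (S : AddSubmonoid M) (u : M) : -u ∈ localizationAt S u :=
  AddSubmonoid.mem_sup_right (AddSubmonoid.subset_closure rfl)

theorem localizationAt_le {S T : AddSubmonoid M} {u : M} (h : S ≤ T) (hu : -u ∈ T) :
    localizationAt S u ≤ T :=
  sup_le h (AddSubmonoid.closure_le.mpr (by rintro _ rfl; exact hu))

theorem mem_localizationAt {S : AddSubmonoid M} {u x : M} :
    x ∈ localizationAt S u ↔ ∃ n : ℕ, x + n • u ∈ S := by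
  constructor
  · intro h
    obtain ⟨s, hs, w, hw, rfl⟩ := AddSubmonoid.mem_sup.mp h
    obtain ⟨n, rfl⟩ := AddSubmonoid.mem_closure_singleton.mp hw
    exact ⟨n, by simpa using hs⟩
  · rintro ⟨n, hn⟩
    have := add_mem (le_localizationAt S u hn)
      (AddSubmonoid.nsmul_mem _ (neg_mem_localizationAt S u) n)
    simpa using this

theorem exists_sub_of_closure_eq_top {S : AddSubmonoid M}
    (hS : AddSubgroup.closure (S : Set M) = ⊤) (x : M) : ∃ a b : S, x = (a : M) - (b : M) := by
  have hx : x ∈ AddSubgroup.closure (S : Set M) := by rw [hS]; trivial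
  induction hx using AddSubgroup.closure_induction with
  | mem x hx => exact ⟨⟨x, hx⟩, 0, by simp⟩
  | zero => exact ⟨0, 0, by simp⟩
  | add x y _ _ hx hy =>
    obtain ⟨a, b, rfl⟩ := hx
    obtain ⟨c, d, rfl⟩ := hy
    exact ⟨a + c, b + d, by push_cast; abel⟩
  | neg x _ hx =>
    obtain ⟨a, b, rfl⟩ := hx
    exact ⟨b, a, by abel⟩

theorem closure_eq_top_of_le {S T : AddSubmonoid M} (h : S ≤ T)
    (hS : AddSubgroup.closure (S : Set M) = ⊤) : AddSubgroup.closure (T : Set M) = ⊤ :=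
  top_le_iff.mp (hS ▸ AddSubgroup.closure_mono h)

/-- A finitely generated monoid generating the group has the whole group as a localization. -/
theorem exists_localizationAt_eq_top {S : AddSubmonoid M} (hfg : S.FG)
    (hS : AddSubgroup.closure (S : Set M) = ⊤) : ∃ u ∈ S, localizationAt S u = ⊤ := by
  obtain ⟨F, hF⟩ := hfg
  have hFS : ∀ f ∈ F, f ∈ S := fun f hf => hF ▸ AddSubmonoid.subset_closure hf
  have hsum : ∑ f ∈ F, f ∈ S := sum_mem hFS
  refine ⟨_, hsum, top_le_iff.mp ?_⟩
  have hneg : ∀ s ∈ S, -s ∈ localizationAt S (∑ f ∈ F, f) := by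
    intro s hs
    rw [← hF] at hs
    induction hs using AddSubmonoid.closure_induction with
    | mem f hf =>
      classical
      -- Inverting the sum of all generators inverts each of them, the remaining summands being in
      -- `S`.
      have h1 : -f = -(∑ f ∈ F, f) + ∑ g ∈ F.erase f, g := by
        rw [← Finset.add_sum_erase F (fun x => x) hf]
        abel
      rw [h1]
      exact add_mem (neg_mem_localizationAt _ _)
        (le_localizationAt _ _ (sum_mem fun g hg => hFS g (Finset.mem_of_mem_erase hg)))
    | zero => simp
    | add x y _ _ hx hy => rw [neg_add]; exact add_mem hx hy
  rintro x -
  obtain ⟨a, b, rfl⟩ := exists_sub_of_closure_eq_top hS x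
  rw [sub_eq_add_neg]
  exact add_mem (le_localizationAt _ _ a.2) (hneg _ b.2)

theorem isMonoidLocalization_top {S T : AddSubmonoid M} (hfg : S.FG)
    (hS : AddSubgroup.closure (S : Set M) = ⊤) (h : S ≤ T) : IsMonoidLocalization T ⊤ := by
  obtain ⟨u, hu, e⟩ := exists_localizationAt_eq_top hfg hS
  refine ⟨u, h hu, (top_le_iff.mp ?_).symm⟩
  rw [← e]
  exact localizationAt_le (h.trans (le_localizationAt _ _)) (neg_mem_localizationAt _ _)

/-- Inverting `u` is the same as inverting `n • u` once saturated. The multiple `n` is there because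
an element of the saturation has only some multiple in `S`, and only that multiple may be inverted
in `S` itself. -/
theorem saturation_localizationAt {S : AddSubmonoid M}
    (hS : AddSubgroup.closure (S : Set M) = ⊤) {u : M} {n : ℕ} (hn : 0 < n) (hu : n • u ∈ S) :
    saturation (localizationAt S (n • u)) = localizationAt (saturation S) u := by
  have husat : u ∈ saturation S := (mem_saturation hS).mpr ⟨n, hn, hu⟩
  ext x
  rw [mem_saturation (closure_eq_top_of_le (le_localizationAt _ _) hS), mem_localizationAt]
  constructor
  · rintro ⟨m, hm, h⟩
    obtain ⟨j, hj⟩ := mem_localizationAt.mp h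
    -- Multiplying `x + (j * n) • u` by `m` needs `m * j` copies of `n • u`; `hj` provides `j` of
    -- them and the others are added.
    refine ⟨j * n, (mem_saturation hS).mpr ⟨m, hm, ?_⟩⟩
    obtain ⟨m, rfl⟩ := Nat.exists_eq_succ_of_ne_zero hm.ne'
    have := add_mem hj (S.nsmul_mem hu (m * j))
    convert this using 1
    simp only [smul_add, smul_smul, add_assoc, ← add_smul]
    congr 2
    simp only [Nat.succ_eq_add_one]
    ring
  · rintro ⟨j, hj⟩
    obtain ⟨m, hm, h⟩ := (mem_saturation hS).mp hj
    refine ⟨m * n, Nat.mul_pos hm hn, mem_localizationAt.mpr ⟨m * j, ?_⟩⟩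
    have := S.nsmul_mem h n
    convert this using 1
    simp only [smul_add, smul_smul]
    congr 2
    · ring
    · ring

theorem saturation_mono {S T : AddSubmonoid M} (h : S ≤ T) : saturation S ≤ saturation T :=
  fun _ hx => ⟨AddSubgroup.closure_mono h hx.1, hx.2.imp fun _ hn => ⟨hn.1, h hn.2⟩⟩

variable {Δ : Set (AddSubmonoid M)}

theorem IsToricCollection.sup_mem (hΔ : IsToricCollection Δ) {S T : AddSubmonoid M} (hS : S ∈ Δ)
    (hT : T ∈ Δ) : S ⊔ T ∈ Δ := by
  obtain ⟨u, hu, h⟩ := hΔ.sup_left S hS T hT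
  rw [h]
  exact hΔ.localization_mem S hS u hu

theorem IsToricCollection.top_mem (hΔ : IsToricCollection Δ) : ⊤ ∈ Δ := by
  obtain ⟨S, hS⟩ := hΔ.nonempty
  obtain ⟨u, hu, h⟩ := exists_localizationAt_eq_top (hΔ.fg S hS) (hΔ.generates S hS)
  rw [← h]
  exact hΔ.localization_mem S hS u hu

/-- The sum of the saturations lies in the saturation of the sum, which is the localization of
`saturation S` at `u`. Conversely it contains `saturation S` and `-u`, the latter already in `S ⊔
T`. -/
theorem IsToricCollection.saturation_sup (hΔ : IsToricCollection Δ) {S T : AddSubmonoid M}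
    (hS : S ∈ Δ) {u : M} (hu : u ∈ S) (h : S ⊔ T = localizationAt S u) :
    saturation S ⊔ saturation T = saturation (S ⊔ T) ∧
      saturation S ⊔ saturation T = localizationAt (saturation S) u := by
  have h1 : saturation (S ⊔ T) = localizationAt (saturation S) u := by
    have := saturation_localizationAt (hΔ.generates S hS) (u := u) one_pos (by simpa using hu)
    rw [h]
    simpa using this
  have h2 : saturation S ⊔ saturation T ≤ saturation (S ⊔ T) :=
    sup_le (saturation_mono le_sup_left) (saturation_mono le_sup_right)
  have h3 : localizationAt (saturation S) u ≤ saturation S ⊔ saturation T := by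
    refine localizationAt_le le_sup_left ?_
    have : -u ∈ S ⊔ T := h ▸ neg_mem_localizationAt S u
    exact sup_le_sup (le_saturation S) (le_saturation T) this
  have h4 := le_antisymm h2 (h1 ▸ h3)
  exact ⟨h4, h4.trans h1⟩

/-- On a toric collection, saturation reflects inclusions. -/
theorem IsToricCollection.le_of_saturation_le (hΔ : IsToricCollection Δ) {S T : AddSubmonoid M}
    (hS : S ∈ Δ) (hT : T ∈ Δ) (h : saturation S ≤ saturation T) : S ≤ T := by
  obtain ⟨w, hw, e⟩ := hΔ.sup_left T hT S hS
  -- Under `h` the sum of the saturations is `saturation T`, so `w` is already invertible there. A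
  -- multiple of `-w` then lies in `T`, and adding copies of `w` gives `-w ∈ T`.
  have h1 := (hΔ.saturation_sup hT hw e).2
  rw [sup_eq_left.mpr h] at h1
  have h2 : -w ∈ saturation T := h1 ▸ neg_mem_localizationAt _ _
  obtain ⟨n, hn, h3⟩ := (mem_saturation (hΔ.generates T hT)).mp h2
  obtain ⟨n, rfl⟩ := Nat.exists_eq_succ_of_ne_zero hn.ne'
  have h4 : -w ∈ T := by
    have := add_mem h3 (T.nsmul_mem hw n)
    convert this using 1
    rw [Nat.succ_eq_add_one, add_smul]
    simp
  have h5 : T ⊔ S ≤ T := e ▸ localizationAt_le le_rfl h4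
  exact le_sup_right.trans h5

theorem IsToricCollection.image_saturation [Module.Free ℤ M] [Module.Finite ℤ M]
    (hΔ : IsToricCollection Δ) : IsToricCollection (saturation '' Δ) where
  nonempty := hΔ.nonempty.image _
  finite := hΔ.finite.image _
  fg := by
    rintro _ ⟨S, hS, rfl⟩
    exact saturation_fg (hΔ.fg S hS) (hΔ.generates S hS)
  generates := by
    rintro _ ⟨S, hS, rfl⟩
    exact closure_eq_top_of_le (le_saturation S) (hΔ.generates S hS)
  localization_mem := by
    rintro _ ⟨S, hS, rfl⟩ u hu
    obtain ⟨n, hn, h⟩ := (mem_saturation (hΔ.generates S hS)).mp hu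
    exact ⟨_, hΔ.localization_mem S hS _ h,
      saturation_localizationAt (hΔ.generates S hS) hn h⟩
  sup_left := by
    rintro _ ⟨S, hS, rfl⟩ _ ⟨T, hT, rfl⟩
    obtain ⟨u, hu, h⟩ := hΔ.sup_left S hS T hT
    exact ⟨u, le_saturation S hu, (hΔ.saturation_sup hS hu h).2⟩
  sup_right := by
    rintro _ ⟨S, hS, rfl⟩ _ ⟨T, hT, rfl⟩
    obtain ⟨u, hu, h⟩ := hΔ.sup_left T hT S hS
    rw [sup_comm]
    exact ⟨u, le_saturation T hu, (hΔ.saturation_sup hT hu h).2⟩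

theorem image_coneMonoid_dualCone [Module.Free ℤ M] (hΔ : IsToricCollection Δ) :
    coneMonoid '' (dualCone '' Δ) = saturation '' Δ := by
  rw [Set.image_image]
  exact Set.image_congr fun S hS => coneMonoid_dualCone (hΔ.fg S hS) (hΔ.generates S hS)

theorem exists_isGeneratingChoice [Module.Free ℤ M] [Module.Finite ℤ M] {S : AddSubmonoid M}
    (hfg : S.FG) (hS : AddSubgroup.closure (S : Set M) = ⊤) :
    ∃ (m : ℕ) (s : Fin m → M) (s' s'' : Fin m → S), IsGeneratingChoice S s s' s'' := by
  obtain ⟨F, hF⟩ := saturation_fg hfg hS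
  choose a b hab using exists_sub_of_closure_eq_top hS
  refine ⟨F.card, fun i => F.equivFin.symm i, fun i => a (F.equivFin.symm i),
    fun i => b (F.equivFin.symm i), ⟨fun i => hab _, ?_⟩⟩
  rw [← hF]
  congr 1
  ext x
  constructor
  · rintro ⟨i, rfl⟩
    exact (F.equivFin.symm i).2
  · intro hx
    exact ⟨F.equivFin ⟨x, hx⟩, by simp⟩

/-! ### The fan -/

theorem dualCone_pointed {S : AddSubmonoid M} (hS : AddSubgroup.closure (S : Set M) = ⊤)
    {v : NReal M} (hv : v ∈ dualCone S) (hv' : -v ∈ dualCone S) : v = 0 := by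
  have h0 : ∀ s ∈ S, v s = 0 := fun s hs => by
    have h1 := hv s hs
    have h2 := hv' s hs
    rw [LinearMap.neg_apply] at h2
    linarith
  ext x
  obtain ⟨a, b, rfl⟩ := exists_sub_of_closure_eq_top hS x
  simp [h0 a a.2, h0 b b.2]

theorem isFace_dualCone_localizationAt {S : AddSubmonoid M} {u : M} (hu : u ∈ S) :
    IsFace (dualCone (localizationAt S u)) (dualCone S) :=
  ⟨evalForm u, fun _ hv => hv u hu, dualCone_localizationAt hu⟩

/-- Every face of the dual cone of a finitely generated monoid is the dual cone of a
localization. -/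
theorem exists_eq_dualCone_localizationAt {S : AddSubmonoid M} (hfg : S.FG)
    {τ : PointedCone ℝ (NReal M)} (h : IsFace τ (dualCone S)) :
    ∃ u ∈ S, τ = dualCone (localizationAt S u) := by
  classical
  obtain ⟨u, hu, hτ⟩ := h
  obtain ⟨F, rfl⟩ := hfg
  set s : Fin F.card → M := fun i => (F.equivFin.symm i).1
  have hs : ∀ i, s i ∈ AddSubmonoid.closure (F : Set M) := fun i =>
    AddSubmonoid.subset_closure (F.equivFin.symm i).2
  obtain ⟨c, hc, rfl⟩ := farkas (fun i => evalForm (s i)) u (by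
    intro v hv
    refine hu v (mem_dualCone_closure.mpr fun x hx => ?_)
    have := hv (F.equivFin ⟨x, hx⟩)
    simpa [s] using this)
  -- The real form `u` is replaced by the sum of the generators that occur in it. On the dual cone
  -- all terms are non-negative, so both vanish exactly where each occurring generator does.
  have hmem : ∑ i with c i ≠ 0, s i ∈ AddSubmonoid.closure (F : Set M) :=
    sum_mem fun i _ => hs i
  refine ⟨_, hmem, ?_⟩
  ext v
  rw [hτ, dualCone_localizationAt hmem]
  refine and_congr_right fun hv => ?_
  have hv' : ∀ i, 0 ≤ v (s i) := fun i => hv _ (hs i)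
  rw [map_sum, Finset.sum_eq_zero_iff_of_nonneg fun i _ => hv' i, LinearMap.sum_apply]
  refine Iff.trans (Finset.sum_eq_zero_iff_of_nonneg (f := fun i => c i * v (s i)) fun i _ => mul_nonneg (hc i) (hv' i)) ?_
  simp [or_iff_not_imp_left]

theorem dualCone_sup (S T : AddSubmonoid M) : dualCone (S ⊔ T) = dualCone S ⊓ dualCone T := by
  ext v
  constructor
  · exact fun h => ⟨fun s hs => h s (AddSubmonoid.mem_sup_left hs),
      fun s hs => h s (AddSubmonoid.mem_sup_right hs)⟩
  · rintro ⟨h1, h2⟩ x hx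
    obtain ⟨s, hs, t, ht, rfl⟩ := AddSubmonoid.mem_sup.mp hx
    rw [map_add]
    exact add_nonneg (h1 s hs) (h2 t ht)

theorem isFan_image_dualCone [Module.Free ℤ M] [Module.Finite ℤ M] (hΔ : IsToricCollection Δ) :
    IsFan (dualCone '' Δ) where
  finite := hΔ.finite.image _
  cone := by
    rintro _ ⟨S, hS, rfl⟩
    exact ⟨exists_dualCone_eq_hull (hΔ.fg S hS), fun v => dualCone_pointed (hΔ.generates S hS)⟩
  face_mem := by
    rintro _ ⟨S, hS, rfl⟩ τ h
    obtain ⟨u, hu, rfl⟩ := exists_eq_dualCone_localizationAt (hΔ.fg S hS) h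
    exact ⟨_, hΔ.localization_mem S hS u hu, rfl⟩
  inf_left := by
    rintro _ ⟨S, hS, rfl⟩ _ ⟨T, hT, rfl⟩
    obtain ⟨u, hu, h⟩ := hΔ.sup_left S hS T hT
    rw [← dualCone_sup, h]
    exact isFace_dualCone_localizationAt hu
  inf_right := by
    rintro _ ⟨S, hS, rfl⟩ _ ⟨T, hT, rfl⟩
    obtain ⟨u, hu, h⟩ := hΔ.sup_right S hS T hT
    rw [← dualCone_sup, h]
    exact isFace_dualCone_localizationAt hu

end Monoids

/-! ### Monoid algebras: domains, integrality and integral closedness. -/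

section MonoidAlgebras

/-- Unique sums, inherited from `ℤʳ`, make the monoid algebras domains and keep extremal terms of
products from cancelling. -/
theorem uniqueSums_of_free (M : Type u) [AddCommGroup M] [Module.Free ℤ M] [Module.Finite ℤ M] :
    UniqueSums M := by
  let b := Module.Free.chooseBasis ℤ M
  exact UniqueSums.of_injective_addHom b.equivFun.toLinearMap.toAddMonoidHom.toAddHom
    b.equivFun.injective inferInstance

/-- The least values of an additive function on the supports of two elements of a monoid algebra
over a domain add up in the product. -/
theorem isLeast_support_mul {k G : Type*} [Semiring k] [NoZeroDivisors k] [AddMonoid G]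
    [UniqueSums G] (v : G →+ ℝ) {f g : AddMonoidAlgebra k G} {a b : ℝ}
    (hf : IsLeast (v '' f.coeff.support) a) (hg : IsLeast (v '' g.coeff.support) b) :
    IsLeast (v '' (f * g).coeff.support) (a + b) := by
  classical
  have hsub : ∀ m ∈ (f * g).coeff.support, ∃ x ∈ f.coeff.support, ∃ y ∈ g.coeff.support,
      x + y = m := by
    intro m hm
    have := AddMonoidAlgebra.support_coeff_mul_subset f g hm
    exact Finset.mem_add.mp this
  constructor
  · obtain ⟨⟨x, hx, hxa⟩, hf2⟩ := hf
    obtain ⟨⟨y, hy, hyb⟩, hg2⟩ := hg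
    -- A unique sum is chosen among the exponents of minimal value. It stays unique in the full
    -- supports, since any other pair with this sum must also have minimal values.
    obtain ⟨x0, hx0, y0, hy0, hu⟩ := UniqueSums.uniqueAdd_of_nonempty
      (A := f.coeff.support.filter fun m => v m = a) (B := g.coeff.support.filter fun m => v m = b)
      ⟨x, Finset.mem_filter.mpr ⟨hx, hxa⟩⟩ ⟨y, Finset.mem_filter.mpr ⟨hy, hyb⟩⟩
    rw [Finset.mem_filter] at hx0 hy0
    have hu' : UniqueAdd f.coeff.support g.coeff.support x0 y0 := by
      intro x1 y1 hx1 hy1 h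
      have h1 : a ≤ v x1 := hf2 ⟨x1, hx1, rfl⟩
      have h2 : b ≤ v y1 := hg2 ⟨y1, hy1, rfl⟩
      have h3 : v x1 + v y1 = a + b := by rw [← map_add, h, map_add, hx0.2, hy0.2]
      exact hu (Finset.mem_filter.mpr ⟨hx1, by linarith⟩)
        (Finset.mem_filter.mpr ⟨hy1, by linarith⟩) h
    refine ⟨x0 + y0, ?_, by rw [map_add, hx0.2, hy0.2]⟩
    rw [Finset.mem_coe, Finsupp.mem_support_iff,
      AddMonoidAlgebra.coeff_mul_add_of_uniqueAdd hu']
    exact mul_ne_zero (Finsupp.mem_support_iff.mp hx0.1) (Finsupp.mem_support_iff.mp hy0.1)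
  · rintro _ ⟨m, hm, rfl⟩
    obtain ⟨x, hx, y, hy, rfl⟩ := hsub m hm
    rw [map_add]
    exact add_le_add (hf.2 ⟨x, hx, rfl⟩) (hg.2 ⟨y, hy, rfl⟩)

theorem isLeast_support_pow {k G : Type*} [Semiring k] [NoZeroDivisors k] [Nontrivial k]
    [AddMonoid G] [UniqueSums G] (v : G →+ ℝ) {f : AddMonoidAlgebra k G} {a : ℝ}
    (hf : IsLeast (v '' f.coeff.support) a) (n : ℕ) :
    IsLeast (v '' (f ^ n).coeff.support) (n * a) := by
  induction n with
  | zero =>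
    simp
  | succ n ih =>
    rw [pow_succ]
    have := isLeast_support_mul v ih hf
    convert this using 1
    push_cast
    ring

/-- A domain which is integrally closed in an integrally closed localization is integrally
closed. -/
theorem isIntegrallyClosed_of_localization {R A : Type*} [CommRing R] [IsDomain R] [CommRing A]
    [Algebra R A] [IsIntegrallyClosed A] (P : Submonoid R) (hP : P ≤ nonZeroDivisors R)
    [IsLocalization P A] (h : ∀ x : A, IsIntegral R x → x ∈ (algebraMap R A).range) :
    IsIntegrallyClosed R := by
  let K := FractionRing R
  let g : A →+* K := IsLocalization.map _ (T := nonZeroDivisors R) (RingHom.id R) hP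
  let := g.toAlgebra
  have : IsScalarTower R A K := IsScalarTower.of_algebraMap_eq
    fun x => (IsLocalization.map_eq (Q := K) (g := RingHom.id R) (S := A) hP x).symm
  have := IsFractionRing.isFractionRing_of_isDomain_of_isLocalization P A K
  rw [isIntegrallyClosed_iff K]
  intro x hx
  obtain ⟨y, rfl⟩ := IsIntegrallyClosed.algebraMap_eq_of_integral (hx.tower_top (A := A))
  obtain ⟨z, rfl⟩ := h y ((isIntegral_algebraMap_iff (IsFractionRing.injective A K)).mp hx)
  exact ⟨z, IsScalarTower.algebraMap_apply R A K z⟩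

variable (k : Type u) [Field k] {M : Type u} [AddCommGroup M]

theorem algebraInclusion_injective {S T : AddSubmonoid M} (h : S ≤ T) :
    Function.Injective (algebraInclusion k h) :=
  AddMonoidAlgebra.mapDomain_injective (AddSubmonoid.inclusion_injective h)

theorem mem_range_algebraInclusion {S T : AddSubmonoid M} (h : S ≤ T) {f : AddMonoidAlgebra k T} :
    f ∈ (algebraInclusion k h).range ↔ ∀ m ∈ f.coeff.support, (m : M) ∈ S := by
  classical
  constructor
  · rintro ⟨g, rfl⟩ m hm
    have : m ∈ (Finsupp.mapDomain (AddSubmonoid.inclusion h) g.coeff).support := hm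
    obtain ⟨s, -, rfl⟩ := Finset.mem_image.mp (Finsupp.mapDomain_support this)
    exact s.2
  · intro hf
    rw [← AddMonoidAlgebra.sum_coeff_single f]
    refine sum_mem fun m hm => ⟨AddMonoidAlgebra.single ⟨m, hf m hm⟩ (f.coeff m), ?_⟩
    rw [algebraInclusion_single]
    rfl

/-- If `T` is cut out of `M` by half-spaces, then `k[T]` is integrally closed in `k[M]`. -/
theorem mem_range_of_isIntegralElem [Module.Free ℤ M] [Module.Finite ℤ M] {T U : AddSubmonoid M}
    (h : T ≤ U) {C : Set (NReal M)} (hT : ∀ m, m ∈ T ↔ ∀ v ∈ C, 0 ≤ v m)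
    {f : AddMonoidAlgebra k U} (hf : (algebraInclusion k h).IsIntegralElem f) :
    f ∈ (algebraInclusion k h).range := by
  classical
  have := uniqueSums_of_free M
  have : UniqueSums U := UniqueSums.of_injective_addHom U.subtype.toAddHom
    Subtype.val_injective inferInstance
  rw [mem_range_algebraInclusion]
  intro m0 hm0
  rw [hT]
  intro v hv
  by_contra! hneg
  let w : U →+ ℝ := v.toAddMonoidHom.comp U.subtype
  obtain ⟨m, hm, hmin⟩ := Finset.exists_min_image f.coeff.support w ⟨m0, hm0⟩
  have hleast : IsLeast (w '' f.coeff.support) (w m) :=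
    ⟨⟨m, hm, rfl⟩, by rintro _ ⟨x, hx, rfl⟩; exact hmin x hx⟩
  have hwm : w m < 0 := (hmin m0 hm0).trans_lt hneg
  obtain ⟨p, hp, hpf⟩ := hf
  rw [hp.as_sum] at hpf
  simp only [Polynomial.eval₂_add, Polynomial.eval₂_X_pow, Polynomial.eval₂_finsetSum,
    Polynomial.eval₂_mul, Polynomial.eval₂_C] at hpf
  -- With `d` the degree of `p`, the power `f ^ d` has a term of value `d * w m`. The other terms of
  -- the equation have values at least `i * w m` with `i < d`, as coefficients from `k[T]`
  -- contribute non-negatively; this exceeds `d * w m` because `w m < 0`.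
  obtain ⟨⟨x, hx, hxw⟩, -⟩ := isLeast_support_pow w hleast p.natDegree
  rw [eq_neg_of_add_eq_zero_left hpf] at hx
  have hx' : x ∈ (∑ i ∈ Finset.range p.natDegree,
      algebraInclusion k h (p.coeff i) * f ^ i).coeff.support := by
    simpa using hx
  rw [Finsupp.mem_support_iff, AddMonoidAlgebra.coeff_sum, Finsupp.finsetSum_apply] at hx'
  obtain ⟨i, hi, hxi⟩ := Finset.exists_ne_zero_of_sum_ne_zero hx'
  have h1 := AddMonoidAlgebra.support_coeff_mul_subset _ _ (Finsupp.mem_support_iff.mpr hxi)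
  obtain ⟨s, hs, y, hy, rfl⟩ := Finset.mem_add.mp h1
  have h2 : 0 ≤ w s := (hT _).mp ((mem_range_algebraInclusion k h).mp ⟨_, rfl⟩ s hs) v hv
  have h3 : i * w m ≤ w y := (isLeast_support_pow w hleast i).2 ⟨y, hy, rfl⟩
  rw [map_add] at hxw
  have h4 : (i : ℝ) < p.natDegree := by exact_mod_cast Finset.mem_range.mp hi
  nlinarith

/-- Some positive power of each monomial lies in `k[S]`, and sums of integral elements are integral.
-/
theorem isIntegral_algebraInclusion_saturation (S : AddSubmonoid M) :
    (algebraInclusion k (le_saturation S)).IsIntegral := by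
  intro f
  induction f using AddMonoidAlgebra.induction_linear with
  | zero => exact RingHom.isIntegralElem_zero _
  | add f g hf hg => exact RingHom.IsIntegralElem.add _ hf hg
  | single m c =>
    obtain ⟨m, hm, n, hn, hnm⟩ := m
    let _ := (algebraInclusion k (le_saturation S)).toAlgebra
    refine IsIntegral.of_pow (R := AddMonoidAlgebra k S) hn ?_
    rw [AddMonoidAlgebra.single_pow]
    have := RingHom.isIntegralElem_map (algebraInclusion k (le_saturation S))
      (x := AddMonoidAlgebra.single ⟨n • m, hnm⟩ (c ^ n))
    rwa [algebraInclusion_single] at this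

variable [Module.Free ℤ M] [Module.Finite ℤ M]

theorem isDomain_addMonoidAlgebra (S : AddSubmonoid M) : IsDomain (AddMonoidAlgebra k S) := by
  have := uniqueSums_of_free M
  have : UniqueSums S := UniqueSums.of_injective_addHom S.subtype.toAddHom
    Subtype.val_injective inferInstance
  infer_instance

/-- A basis of `M` presents `k[M]` as the localization of a polynomial ring at a monomial, and
localization preserves integral closedness. -/
theorem isIntegrallyClosed_top : IsIntegrallyClosed (AddMonoidAlgebra k (⊤ : AddSubmonoid M)) := by
  classical
  let b := Module.Free.chooseBasis ℤ M
  let φ : (Module.Free.ChooseBasisIndex ℤ M →₀ ℕ) →+ M :=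
    Finsupp.liftAddHom fun i => (multiplesHom M (b i))
  have hφ : ∀ p i, b.repr (φ p) i = p i := by
    intro p i
    simp [φ, Finsupp.sum, Finsupp.single_apply]
    exact fun h => h.symm ▸ rfl
  have hinj : Function.Injective φ := fun p q h => by
    ext i
    have h1 := hφ p i
    rw [h, hφ] at h1
    exact_mod_cast h1.symm
  let e := AddMonoidHom.mrangeRestrict φ
  have he : Function.Bijective e :=
    ⟨fun p q h => hinj (congrArg Subtype.val h), AddMonoidHom.mrangeRestrict_surjective φ⟩
  let S := AddMonoidHom.mrange φ
  have hS : IsIntegrallyClosed (AddMonoidAlgebra k S) := by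
    have : IsIntegrallyClosed (MvPolynomial (Module.Free.ChooseBasisIndex ℤ M) k) := inferInstance
    exact IsIntegrallyClosed.of_equiv
      (AddMonoidAlgebra.mapDomainRingEquiv k (AddEquiv.ofBijective e he))
  have hfg : S.FG := by
    refine ⟨Finset.univ.image b, le_antisymm (AddSubmonoid.closure_le.mpr ?_) ?_⟩
    · rintro _ hx
      obtain ⟨i, -, rfl⟩ := Finset.mem_image.mp hx
      exact ⟨Finsupp.single i 1, by simp [φ]⟩
    · rintro _ ⟨p, rfl⟩
      simp only [φ, Finsupp.liftAddHom_apply, Finsupp.sum]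
      exact sum_mem fun i _ => AddSubmonoid.nsmul_mem _
        (AddSubmonoid.subset_closure (by simp)) _
  have hgen : AddSubgroup.closure (S : Set M) = ⊤ := by
    refine top_le_iff.mp fun x _ => ?_
    rw [← b.sum_repr x]
    refine sum_mem fun i _ => AddSubgroup.zsmul_mem _ (AddSubgroup.subset_closure ?_) _
    exact ⟨Finsupp.single i 1, by simp [φ]⟩
  obtain ⟨u, hu, htop⟩ := isMonoidLocalization_top hfg hgen le_rfl
  let _ := (algebraInclusion k (le_top : S ≤ ⊤)).toAlgebra
  have := isLocalization_algebraInclusion k hu le_top htop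
  have := isDomain_addMonoidAlgebra k S
  refine isIntegrallyClosed_of_isLocalization _ (Submonoid.powers
    (AddMonoidAlgebra.single (⟨u, hu⟩ : S) (1 : k))) (powers_le_nonZeroDivisors_of_noZeroDivisors ?_)
  rw [Ne, AddMonoidAlgebra.single_eq_zero]
  exact one_ne_zero

/-- The monoid algebra of a saturated monoid is integrally closed. -/
theorem isIntegrallyClosed_saturation {S : AddSubmonoid M} (hfg : S.FG)
    (hS : AddSubgroup.closure (S : Set M) = ⊤) :
    IsIntegrallyClosed (AddMonoidAlgebra k (saturation S)) := by
  obtain ⟨u, hu, htop⟩ := isMonoidLocalization_top hfg hS (le_saturation S)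
  let φ := algebraInclusion k (le_top : saturation S ≤ ⊤)
  let _ := φ.toAlgebra
  have := isLocalization_algebraInclusion k hu le_top htop
  have := isDomain_addMonoidAlgebra k (saturation S)
  have := isIntegrallyClosed_top k (M := M)
  refine isIntegrallyClosed_of_localization (A := AddMonoidAlgebra k (⊤ : AddSubmonoid M))
    (Submonoid.powers (AddMonoidAlgebra.single (⟨u, hu⟩ : saturation S) (1 : k)))
    (powers_le_nonZeroDivisors_of_noZeroDivisors ?_) fun y hy => ?_
  · rw [Ne, AddMonoidAlgebra.single_eq_zero]
    exact one_ne_zero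
  · exact mem_range_of_isIntegralElem k le_top (C := (dualCone S : Set (NReal M)))
      (fun m => by rw [← coneMonoid_dualCone hfg hS]; rfl) hy

end MonoidAlgebras

/-! ### A criterion for an integral extension to be a blow-up. -/

section BlowupPrincipal

variable {R B : Type u} [CommRing R] [CommRing B] (I : Ideal R)

/-- The element `r tⁿ` of the Rees algebra. -/
noncomputable def reesMonomial {n : ℕ} {r : R} (hr : r ∈ I ^ n) : reesAlgebra I :=
  ⟨Polynomial.monomial n r, reesAlgebra.monomial_mem.mpr hr⟩

theorem reesMonomial_mem {n : ℕ} {r : R} (hr : r ∈ I ^ n) : reesMonomial I hr ∈ reesGrading I n :=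
  ⟨r, rfl⟩

theorem exists_eq_reesMonomial {n : ℕ} {a : reesAlgebra I} (ha : a ∈ reesGrading I n) :
    ∃ (r : R) (hr : r ∈ I ^ n), a = reesMonomial I hr := by
  obtain ⟨r, hr⟩ := ha
  change _ = (a : Polynomial R) at hr
  have h := a.2
  rw [← hr, reesAlgebra.monomial_mem] at h
  exact ⟨r, h, Subtype.ext hr.symm⟩

variable {I} {φ : R →+* B} {f : R}

theorem exists_eq_mul_of_mem_pow (hprin : ∀ r ∈ I, φ r ∈ Ideal.span {φ f}) {n : ℕ} {r : R}
    (hr : r ∈ I ^ n) : ∃ b, φ r = φ f ^ n * b := by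
  have h1 : I ≤ (Ideal.span {φ f}).comap φ := hprin
  have h2 := (Ideal.pow_right_mono h1 n).trans (Ideal.le_comap_pow φ n) hr
  rw [Ideal.mem_comap, Ideal.span_singleton_pow, Ideal.mem_span_singleton] at h2
  exact h2

/-- The element `f t` lies in no relevant homogeneous prime ideal. -/
theorem basicOpen_reesMonomial_eq_top (hinj : Function.Injective φ) (hint : φ.IsIntegral)
    (hf : f ∈ I ^ 1) (hprin : ∀ r ∈ I, φ r ∈ Ideal.span {φ f}) :
    Proj.basicOpen (reesGrading I) (reesMonomial I hf) = ⊤ := by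
  rw [eq_top_iff]
  intro x _
  rw [Proj.mem_basicOpen]
  intro hx
  refine x.not_irrelevant_le ?_
  refine (HomogeneousIdeal.toIdeal_irrelevant_le _).mpr ?_
  intro n hn c hc
  obtain ⟨r, hr, rfl⟩ := exists_eq_reesMonomial I hc
  obtain ⟨b, hb⟩ := exists_eq_mul_of_mem_pow hprin hr
  obtain ⟨p, hp, hpb⟩ := hint b
  have h1 := Polynomial.scaleRoots_eval₂_eq_zero φ (s := f ^ n) hpb
  rw [map_pow, ← hb, Polynomial.eval₂_at_apply, map_eq_zero_iff φ hinj,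
    Polynomial.eval_eq_sum_range, Polynomial.natDegree_scaleRoots,
    Finset.sum_range_succ] at h1
  -- The integral equation of `b = r / fⁿ`, cleared of denominators and pulled back to `R` by
  -- injectivity, is homogeneous of degree `n * p.natDegree` in the Rees algebra. Each term on the
  -- right has a positive power of `f t`, so the prime containing `f t` also contains `r tⁿ`.
  have h2 : reesMonomial I hr ^ p.natDegree = -∑ i ∈ Finset.range p.natDegree,
      p.coeff i • (reesMonomial I hf ^ (n * (p.natDegree - i)) * reesMonomial I hr ^ i) := by
    apply Subtype.ext
    push_cast
    simp only [reesMonomial, Polynomial.monomial_pow, Polynomial.monomial_mul_monomial,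
      Polynomial.smul_monomial, one_mul]
    rw [Finset.sum_congr rfl (g := fun i => Polynomial.monomial (n * p.natDegree)
      (p.coeff i • (f ^ (n * (p.natDegree - i)) * r ^ i))) fun i hi => ?_]
    · rw [← map_sum, ← map_neg]
      congr 1
      rw [eq_neg_iff_add_eq_zero, add_comm, ← h1]
      simp only [Polynomial.coeff_scaleRoots, hp.coeff_natDegree, ← pow_mul]
      simp [mul_assoc]
    · rw [← mul_add, Nat.sub_add_cancel (Finset.mem_range.mp hi).le]
  refine x.isPrime.mem_of_pow_mem p.natDegree ?_
  rw [h2]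
  refine neg_mem (sum_mem fun i hi => ?_)
  rw [Algebra.smul_def]
  refine Ideal.mul_mem_left _ _ (Ideal.mul_mem_right _ _ (Ideal.pow_mem_of_mem _ hx _ ?_))
  have := Finset.mem_range.mp hi
  exact Nat.mul_pos hn (by omega)

/-- The degree zero part of the Rees algebra localized at `f t` is identified with `B`. -/
theorem exists_away_bijective (K : Type*) [Field K] [Algebra B K] [IsFractionRing B K]
    (hinj : Function.Injective φ)
    (hf : f ∈ I ^ 1) (hf0 : φ f ≠ 0) (hprin : ∀ r ∈ I, φ r ∈ Ideal.span {φ f})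
    (hgen : ∀ b, ∃ n, ∃ r ∈ I ^ n, φ f ^ n * b = φ r) :
    ∃ e : HomogeneousLocalization.Away (reesGrading I) (reesMonomial I hf) →+* B,
      Function.Bijective e ∧ ∀ r, e (HomogeneousLocalization.fromZeroRingHom (reesGrading I) _
        (algebraMap R (reesGrading I 0) r)) = φ r := by
  let ι : B →+* K := algebraMap B K
  have hι : Function.Injective ι := IsFractionRing.injective B K
  have hιf : ι (φ f) ≠ 0 := fun h => hf0 (hι (h.trans (map_zero ι).symm))
  -- Evaluation at `t = 1 / f` sends `f t` to `1`, hence extends to the localization. The fraction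
  -- field is only an auxiliary target: `hprin` puts the degree zero values in `B`, and `hgen` makes
  -- them fill `B`.
  let ε : reesAlgebra I →+* K :=
    (Polynomial.eval₂RingHom (ι.comp φ) (ι (φ f))⁻¹).comp (reesAlgebra I).val.toRingHom
  have hε : ∀ {n : ℕ} {r : R} (hr : r ∈ I ^ n),
      ε (reesMonomial I hr) = ι (φ r) * (ι (φ f))⁻¹ ^ n := fun hr =>
    Polynomial.eval₂_monomial _ _
  have hεf : ε (reesMonomial I hf) = 1 := by
    rw [hε, pow_one, mul_inv_cancel₀ hιf]
  let l : Localization.Away (reesMonomial I hf) →+* K :=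
    Localization.awayLift ε (reesMonomial I hf) (by rw [hεf]; exact isUnit_one)
  have hl : ∀ a, l (algebraMap _ _ a) = ε a := fun a => IsLocalization.Away.lift_eq _ _ a
  let ψ : HomogeneousLocalization.Away (reesGrading I) (reesMonomial I hf) →+* K :=
    l.comp (algebraMap _ _)
  have hψval : ∀ x, ψ x = l x.val := fun _ => rfl
  have hlmk : ∀ n a, l (Localization.mk a
      (⟨reesMonomial I hf ^ n, n, rfl⟩ : Submonoid.powers (reesMonomial I hf))) = ε a := by
    intro n a
    rw [Localization.mk_eq_mk', ← hl a, ← IsLocalization.mk'_spec (Localization.Away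
      (reesMonomial I hf)) a (⟨reesMonomial I hf ^ n, n, rfl⟩ : Submonoid.powers
      (reesMonomial I hf)), map_mul, hl, map_pow, hεf, one_pow, mul_one]
  have hψ : ∀ x, ∃ (n : ℕ) (r : R) (hr : r ∈ I ^ n), ψ x = ι (φ r) * (ι (φ f))⁻¹ ^ n ∧
      x.val = Localization.mk (reesMonomial I hr)
        (⟨reesMonomial I hf ^ n, n, rfl⟩ : Submonoid.powers (reesMonomial I hf)) := by
    intro x
    obtain ⟨n, a, ha, rfl⟩ := HomogeneousLocalization.Away.mk_surjective _
      (reesMonomial_mem I hf) x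
    have ha' := ha
    rw [smul_eq_mul, mul_one] at ha'
    obtain ⟨r, hr, rfl⟩ := exists_eq_reesMonomial I ha'
    have hval := HomogeneousLocalization.Away.val_mk (reesGrading I) n (reesMonomial_mem I hf)
      (reesMonomial I hr) ha
    exact ⟨n, r, hr, by rw [hψval, hval, hlmk, hε], hval⟩
  have hψinj : Function.Injective ψ := by
    rw [injective_iff_map_eq_zero]
    intro x hx
    obtain ⟨n, r, hr, h1, h2⟩ := hψ x
    rw [hx, eq_comm, mul_eq_zero, or_iff_left (pow_ne_zero _ (inv_ne_zero hιf)),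
      map_eq_zero_iff ι hι, map_eq_zero_iff φ hinj] at h1
    subst h1
    apply HomogeneousLocalization.val_injective
    rw [h2, HomogeneousLocalization.val_zero]
    have : reesMonomial I hr = 0 := Subtype.ext (Polynomial.monomial_zero_right n)
    rw [this, Localization.mk_zero]
  have hmem : ∀ x, ∃ b, ι b = ψ x := by
    intro x
    obtain ⟨n, r, hr, h1, -⟩ := hψ x
    obtain ⟨b, hb⟩ := exists_eq_mul_of_mem_pow hprin hr
    refine ⟨b, ?_⟩
    rw [h1, hb, map_mul, map_pow, inv_pow]
    field_simp
  choose g hg using hmem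
  have hsurj : Function.Surjective g := by
    intro b
    obtain ⟨n, r, hr, h⟩ := hgen b
    refine ⟨HomogeneousLocalization.Away.mk _ (reesMonomial_mem I hf) n (reesMonomial I hr)
      (by simpa using reesMonomial_mem I hr), hι ?_⟩
    rw [hg, hψval, HomogeneousLocalization.Away.val_mk, hlmk, hε, ← h, map_mul, map_pow, inv_pow]
    field_simp
  let g' : HomogeneousLocalization.Away (reesGrading I) (reesMonomial I hf) →+* B :=
    { toFun := g
      map_one' := hι (by rw [hg, map_one, map_one])
      map_zero' := hι (by rw [hg, map_zero, map_zero])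
      map_add' := fun x y => hι (by rw [hg, map_add, map_add, hg, hg])
      map_mul' := fun x y => hι (by rw [hg, map_mul, map_mul, hg, hg]) }
  refine ⟨g', ⟨fun x y h => hψinj ?_, hsurj⟩, fun r => hι ?_⟩
  · rw [← hg, ← hg]
    exact congrArg ι h
  · refine (hg _).trans ((hψval _).trans ?_)
    have : HomogeneousLocalization.val (HomogeneousLocalization.fromZeroRingHom (reesGrading I)
        (Submonoid.powers (reesMonomial I hf)) (algebraMap R (reesGrading I 0) r)) =
        algebraMap _ _ (algebraMap R (reesAlgebra I) r) :=
      Localization.mk_one_eq_algebraMap _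
    rw [this, hl]
    exact Polynomial.eval₂_C _ _

theorem exists_specMap_iso_comp {R A X B : Type u} [CommRing R] [CommRing A] [CommRing X]
    [CommRing B] (g : R →+* A) (h : A →+* X) (e : X →+* B)
    (hbij : Function.Bijective e) {φ : R →+* B} (he : ∀ r, e (h (g r)) = φ r) :
    ∃ i : Spec (CommRingCat.of B) ≅ Spec (CommRingCat.of X),
      i.hom ≫ Spec.map (CommRingCat.ofHom h) ≫ Spec.map (CommRingCat.ofHom g) =
        Spec.map (CommRingCat.ofHom φ) := by
  refine ⟨asIso (Spec.map (RingEquiv.ofBijective e hbij).toCommRingCatIso.hom), ?_⟩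
  rw [asIso_hom, ← Spec.map_comp, ← Spec.map_comp]
  congr 1
  exact CommRingCat.hom_ext (RingHom.ext he)

/-- Let `R ⊆ B` be an integral extension, and let `f ∈ I` be such that `I B = f B` and every element
of `B` is of the form `r / fⁿ` with `r ∈ Iⁿ`. Then `Spec B` is the blow-up of `Spec R` in `I`. -/
theorem exists_iso_blowup [IsDomain B] (hinj : Function.Injective φ) (hint : φ.IsIntegral)
    (hfI : f ∈ I) (hf0 : φ f ≠ 0) (hprin : ∀ r ∈ I, φ r ∈ Ideal.span {φ f})
    (hgen : ∀ b, ∃ n, ∃ r ∈ I ^ n, φ f ^ n * b = φ r) :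
    ∃ e : Spec (CommRingCat.of B) ≅ blowup I,
      e.hom ≫ blowupMap I = Spec.map (CommRingCat.ofHom φ) := by
  have hf : f ∈ I ^ 1 := by rwa [pow_one]
  obtain ⟨e, hbij, he⟩ := exists_away_bijective (FractionRing B) hinj hf hf0 hprin hgen
  let j : Spec (CommRingCat.of (HomogeneousLocalization.Away (reesGrading I)
      (reesMonomial I hf))) ⟶ blowup I :=
    Proj.awayι (reesGrading I) (reesMonomial I hf) (reesMonomial_mem I hf) one_pos
  have hj : j ≫ blowupMap I =
      Spec.map (CommRingCat.ofHom (HomogeneousLocalization.fromZeroRingHom (reesGrading I) _)) ≫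
        (Spec.map (CommRingCat.ofHom (algebraMap R (reesGrading I 0))) :
          Spec (CommRingCat.of (reesGrading I 0)) ⟶ Spec (CommRingCat.of R)) :=
    Proj.awayι_toSpecZero_assoc _ _ _ _ _
  have : IsIso j :=
    have : IsOpenImmersion j := inferInstanceAs (IsOpenImmersion (Proj.awayι _ _ _ _))
    isIso_of_isOpenImmersion_of_opensRange_eq_top _ ((Proj.opensRange_awayι _ _ _ _).trans
      (basicOpen_reesMonomial_eq_top hinj hint hf hprin))
  obtain ⟨i, hi⟩ := exists_specMap_iso_comp
    (A := reesGrading I 0) (X := HomogeneousLocalization.Away (reesGrading I) (reesMonomial I hf))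
    (φ := φ) (algebraMap R (reesGrading I 0)) (HomogeneousLocalization.fromZeroRingHom
      (reesGrading I) (Submonoid.powers (reesMonomial I hf))) e hbij
      (fun r => he r)
  refine ⟨i ≪≫ asIso j, ?_⟩
  rw [Iso.trans_hom, asIso_hom, Category.assoc, hj]
  exact hi

end BlowupPrincipal

/-! ### The product ideal satisfies the blow-up criterion. -/

section AffineBlowup

variable (k : Type u) [Field k] {M : Type u} [AddCommGroup M] {S : AddSubmonoid M}

/-- The product `∏ᵢ t^{s_i''}`, which generates the inverse image of the ideal. -/
noncomputable def denominator {m : ℕ} (s'' : Fin m → S) : AddMonoidAlgebra k S :=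
  ∏ i, AddMonoidAlgebra.single (s'' i) (1 : k)

variable {m : ℕ} {s : Fin m → M} {s' s'' : Fin m → S}

theorem denominator_mem_productIdeal : denominator k s'' ∈ productIdeal k s' s'' :=
  Ideal.prod_mem_prod fun _ _ => Ideal.subset_span (by simp)

theorem IsGeneratingChoice.mem_saturation (h : IsGeneratingChoice S s s' s'') (i : Fin m) :
    s i ∈ saturation S :=
  h.closure_eq ▸ AddSubmonoid.subset_closure ⟨i, rfl⟩

theorem IsGeneratingChoice.single_eq (h : IsGeneratingChoice S s s' s'') (i : Fin m) :
    algebraInclusion k (le_saturation S) (AddMonoidAlgebra.single (s' i) 1) =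
      algebraInclusion k (le_saturation S) (AddMonoidAlgebra.single (s'' i) 1) *
        AddMonoidAlgebra.single (⟨s i, h.mem_saturation i⟩ : saturation S) 1 := by
  rw [algebraInclusion_single, algebraInclusion_single, AddMonoidAlgebra.single_mul_single, mul_one]
  congr 1
  ext
  simp [h.eq_sub i]

/-- Over the saturation `t^{s_i'}` is a multiple of `t^{s_i''}`, so each factor of the ideal becomes
principal, and so does the product. -/
theorem IsGeneratingChoice.map_productIdeal_le (h : IsGeneratingChoice S s s' s'')
    (r : AddMonoidAlgebra k S) (hr : r ∈ productIdeal k s' s'') :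
    algebraInclusion k (le_saturation S) r ∈
      Ideal.span {algebraInclusion k (le_saturation S) (denominator k s'')} := by
  suffices (productIdeal k s' s'').map (algebraInclusion k (le_saturation S)) ≤
      Ideal.span {algebraInclusion k (le_saturation S) (denominator k s'')} from
    this (Ideal.mem_map_of_mem _ hr)
  rw [productIdeal, ← Ideal.mapHom_apply, map_prod, denominator, map_prod,
    ← Ideal.prod_span_singleton]
  refine Finset.prod_le_prod' fun i _ => ?_
  rw [Ideal.mapHom_apply, Ideal.map_span, Ideal.span_le]
  rintro _ ⟨x, rfl | rfl, rfl⟩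
  · rw [h.single_eq k]
    exact Ideal.mul_mem_right _ _ (Ideal.subset_span rfl)
  · exact Ideal.subset_span rfl

/-- Every element of `k[S^sat]` is of the form `r / fⁿ` with `r ∈ Iⁿ`. -/
theorem IsGeneratingChoice.exists_mul_eq (h : IsGeneratingChoice S s s' s'')
    (b : AddMonoidAlgebra k (saturation S)) :
    ∃ n, ∃ r ∈ productIdeal k s' s'' ^ n,
      algebraInclusion k (le_saturation S) (denominator k s'') ^ n * b =
        algebraInclusion k (le_saturation S) r := by
  classical
  set φ := algebraInclusion k (le_saturation S)
  set f := denominator k s''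
  set I := productIdeal k s' s''
  have hmono : ∀ x (hx : x ∈ AddSubmonoid.closure (Set.range s)) (hx' : x ∈ saturation S),
      ∃ n, ∃ r ∈ I ^ n, φ f ^ n * AddMonoidAlgebra.single (⟨x, hx'⟩ : saturation S) (1 : k) =
        φ r := by
    intro x hx
    induction hx using AddSubmonoid.closure_induction with
    | mem x hx =>
      obtain ⟨i, rfl⟩ := hx
      intro hx'
      -- For a generator, `f * t^{s_i}` is `f` with the factor `t^{s_i''}` exchanged for `t^{s_i'}`,
      -- which is again a product of generators of the factors of `I`.
      refine ⟨1, (AddMonoidAlgebra.single (s' i) 1) *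
        ∏ j ∈ Finset.univ.erase i, AddMonoidAlgebra.single (s'' j) (1 : k), ?_, ?_⟩
      · rw [pow_one]
        change _ ∈ ∏ i, _
        rw [← Finset.mul_prod_erase _ _ (Finset.mem_univ i)]
        exact Ideal.mul_mem_mul (Ideal.subset_span (by simp))
          (Ideal.prod_mem_prod fun _ _ => Ideal.subset_span (by simp))
      · rw [pow_one, map_mul, h.single_eq k]
        change φ (∏ i, _) * _ = _
        rw [← Finset.mul_prod_erase _ _ (Finset.mem_univ i), map_mul]
        ring
    | zero => exact fun hx' => ⟨0, 1, by simp, by rw [pow_zero, one_mul, map_one]; rfl⟩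
    | add x y hx hy ihx ihy =>
      intro hxy
      obtain ⟨n, r, hr, h1⟩ := ihx (h.closure_eq ▸ hx)
      obtain ⟨n', r', hr', h2⟩ := ihy (h.closure_eq ▸ hy)
      refine ⟨n + n', r * r', pow_add I n n' ▸ Ideal.mul_mem_mul hr hr', ?_⟩
      rw [map_mul, ← h1, ← h2, mul_mul_mul_comm, ← pow_add, AddMonoidAlgebra.single_mul_single,
        mul_one]
      rfl
  induction b using AddMonoidAlgebra.induction_linear with
  | zero => exact ⟨0, 0, by simp, by simp⟩
  | add x y hx hy =>
    obtain ⟨n, r, hr, h1⟩ := hx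
    obtain ⟨n', r', hr', h2⟩ := hy
    have hf : f ∈ I := denominator_mem_productIdeal k
    refine ⟨n + n', f ^ n' * r + f ^ n * r', add_mem ?_ ?_, ?_⟩
    · rw [add_comm n, pow_add]
      exact Ideal.mul_mem_mul (Ideal.pow_mem_pow hf _) hr
    · rw [pow_add]
      exact Ideal.mul_mem_mul (Ideal.pow_mem_pow hf _) hr'
    · rw [map_add, map_mul, map_mul, ← h1, ← h2, map_pow, map_pow]
      ring
  | single x c =>
    obtain ⟨x, hx⟩ := x
    obtain ⟨n, r, hr, h1⟩ := hmono x (h.closure_eq ▸ hx) hx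
    refine ⟨n, AddMonoidAlgebra.single 0 c * r, Ideal.mul_mem_left _ _ hr, ?_⟩
    rw [map_mul, ← h1, algebraInclusion_single, mul_left_comm, AddMonoidAlgebra.single_mul_single,
      mul_one, map_zero, zero_add]

theorem exists_affineToric_iso_blowup [Module.Free ℤ M] [Module.Finite ℤ M]
    (h : IsGeneratingChoice S s s' s'') :
    ∃ e : affineToric k (saturation S) ≅ blowup (productIdeal k s' s''),
      e.hom ≫ blowupMap (productIdeal k s' s'') = affineToricMap k (le_saturation S) := by
  have := isDomain_addMonoidAlgebra k (saturation S)
  have := isDomain_addMonoidAlgebra k S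
  have hinj := algebraInclusion_injective k (le_saturation S)
  refine exists_iso_blowup hinj (isIntegral_algebraInclusion_saturation k S)
    (denominator_mem_productIdeal k) ?_ (h.map_productIdeal_le k) (h.exists_mul_eq k)
  rw [Ne, map_eq_zero_iff _ hinj, denominator, Finset.prod_eq_zero_iff]
  rintro ⟨i, -, hi⟩
  rw [AddMonoidAlgebra.single_eq_zero] at hi
  exact one_ne_zero hi

end AffineBlowup

/-! ### Recognizing normalizations of integral schemes. -/

section NormalizationCriterion

theorem exists_iso_fromSpecStalk_genericPoint {T X : Scheme.{u}} [IsIntegral T] [IsIntegral X]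
    (f : T ⟶ X) [IsOpenImmersion f] :
    ∃ e : Spec (X.presheaf.stalk (genericPoint X)) ≅ Spec (T.presheaf.stalk (genericPoint T)),
      e.hom ≫ T.fromSpecStalk (genericPoint T) ≫ f = X.fromSpecStalk (genericPoint X) := by
  rw [← genericPoint_eq_of_isOpenImmersion f, ← Scheme.SpecMap_stalkMap_fromSpecStalk]
  exact ⟨(asIso (Spec.map (f.stalkMap (genericPoint T)))).symm, by simp⟩

/-- `B` sits between `A` and its fraction field and is integral over `A`, so it cannot be larger
than `A`. -/
theorem bijective_of_isIntegral_of_isIntegrallyClosed {A B K : Type*} [CommRing A] [CommRing B]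
    [Field K] [Algebra A K] [IsFractionRing A K] [IsIntegrallyClosed A] {φ : A →+* B}
    (hφ : φ.IsIntegral) {ψ : B →+* K} (hψ : Function.Injective ψ)
    (h : ∀ a, ψ (φ a) = algebraMap A K a) : Function.Bijective φ := by
  refine ⟨fun a b hab => IsFractionRing.injective A K (by rw [← h, ← h, hab]), fun b => ?_⟩
  have hb : _root_.IsIntegral A (ψ b) := by
    have : (algebraMap A K) = ψ.comp φ := RingHom.ext fun a => (h a).symm
    change (algebraMap A K).IsIntegralElem _
    rw [this]
    exact RingHom.IsIntegralElem.map (hφ b) ψ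
  obtain ⟨a, ha⟩ := IsIntegrallyClosed.isIntegral_iff.mp hb
  exact ⟨a, hψ (by rw [h, ha])⟩

/-- A normal scheme has no proper integral birational modification. Dominance of `t` embeds the
sections of `Z` over an affine `V` in the function field of `Y`, which reduces the claim to the ring
statement. -/
theorem isIso_of_isIntegralHom_of_isIntegrallyClosed {Y Z : Scheme.{u}} [IsIntegral Y]
    (h : Z ⟶ Y) [IsIntegralHom h] (t : Spec (Y.presheaf.stalk (genericPoint Y)) ⟶ Z)
    [QuasiCompact t] [IsSchemeTheoreticallyDominant t]
    (ht : t ≫ h = Y.fromSpecStalk (genericPoint Y))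
    (hY : ∀ y : Y, ∃ V : Y.Opens, y ∈ V ∧ IsAffineOpen V ∧ IsIntegrallyClosed Γ(Y, V)) :
    IsIso h := by
  refine (MorphismProperty.isomorphisms.iff _).mp ?_
  refine IsZariskiLocalAtTarget.of_forall_exists_morphismRestrict (P := .isomorphisms _) fun y => ?_
  obtain ⟨V, hyV, hV, hVc⟩ := hY y
  refine ⟨V, hyV, ?_⟩
  rw [MorphismProperty.isomorphisms.iff, isIso_morphismRestrict_iff_isIso_app h hV,
    ConcreteCategory.isIso_iff_bijective]
  have : Nonempty V := ⟨⟨y, hyV⟩⟩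
  have : IsFractionRing Γ(Y, V) Y.functionField :=
    functionField_isFractionRing_of_isAffineOpen (X := Y) V hV
  have hη : genericPoint Y ∈ V :=
    ((genericPoint_spec Y).mem_open_set_iff V.isOpen).mpr (by simpa using ‹Nonempty V›)
  have htop : t ⁻¹ᵁ (h ⁻¹ᵁ V) = ⊤ := by
    rw [← Scheme.Hom.comp_preimage, ht]
    exact Scheme.preimage_eq_top_of_closedPoint_mem _ (by rwa [Scheme.fromSpecStalk_closedPoint])
  let ψ : Γ(Z, h ⁻¹ᵁ V) ⟶ Y.presheaf.stalk (genericPoint Y) :=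
    t.appLE (h ⁻¹ᵁ V) ⊤ htop.ge ≫ (Scheme.ΓSpecIso _).hom
  have hψ : h.app V ≫ ψ = Y.presheaf.germ V (genericPoint Y) hη := by
    simp only [ψ, Scheme.Hom.app_eq_appLE, Scheme.Hom.appLE_comp_appLE_assoc, ht]
    rw [Scheme.Hom.appLE, Scheme.fromSpecStalk_app hη]
    simp only [Category.assoc, ← Functor.map_comp_assoc]
    erw [CategoryTheory.Functor.map_id, Category.id_comp, Iso.inv_hom_id, Category.comp_id]
  refine bijective_of_isIntegral_of_isIntegrallyClosed (K := Y.functionField)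
    (IsIntegralHom.isIntegral_app h V hV) (ψ := ψ.hom) ?_ fun a => congr($hψ a)
  have : IsIso ((Spec (Y.presheaf.stalk (genericPoint Y))).presheaf.map (homOfLE htop.ge).op) := by
    rw [show (homOfLE htop.ge).op = eqToHom (congrArg op htop) from rfl]
    infer_instance
  simp only [ψ, Scheme.Hom.appLE, CommRingCat.hom_comp, RingHom.coe_comp]
  exact ((ConcreteCategory.bijective_of_isIso _).1.comp
    ((ConcreteCategory.bijective_of_isIso _).1.comp (t.app_injective _)))

/-- The common open subscheme `T` identifies the generic points of `X` and `Y`. The universal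
property of relative normalization then gives an integral morphism from the normalization to `Y`, an
isomorphism since `Y` is normal. -/
theorem isNormalization_of_isIntegralHom {T X Y : Scheme.{u}} [IsIntegral T] [IsIntegral X]
    [IsIntegral Y] (ν : Y ⟶ X) [IsIntegralHom ν] (j : T ⟶ Y) [IsOpenImmersion j]
    [IsOpenImmersion (j ≫ ν)]
    (hY : ∀ y : Y, ∃ V : Y.Opens, y ∈ V ∧ IsAffineOpen V ∧ IsIntegrallyClosed Γ(Y, V)) :
    IsNormalization ν := by
  obtain ⟨e₁, h₁⟩ := exists_iso_fromSpecStalk_genericPoint j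
  obtain ⟨e₂, h₂⟩ := exists_iso_fromSpecStalk_genericPoint (j ≫ ν)
  let f := X.fromSpecStalk (genericPoint X)
  have hf : f = (e₂.hom ≫ e₁.inv ≫ Y.fromSpecStalk (genericPoint Y)) ≫ ν := by
    simp only [Category.assoc, ← h₁, Iso.inv_hom_id_assoc, h₂, f]
  have : IsSchemeTheoreticallyDominant f.toNormalization := ⟨f.ker_toNormalization⟩
  let h := f.normalizationDesc _ ν hf
  have ht : ((e₁.hom ≫ e₂.inv) ≫ f.toNormalization) ≫ h = Y.fromSpecStalk (genericPoint Y) := by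
    simp [h]
  have : IsIso h := isIso_of_isIntegralHom_of_isIntegrallyClosed h _ ht hY
  exact ⟨inferInstance, (asIso h).symm,
    (IsIso.inv_comp_eq h).mpr (f.normalizationDesc_comp _ ν hf).symm⟩

end NormalizationCriterion

/-! ### Gluing: charts, integrality and normalization of toric varieties. -/

section ToricVarieties

variable (k : Type u) [Field k] {M : Type u} [AddCommGroup M] {Δ : Set (AddSubmonoid M)}
  (hΔ : IsToricCollection Δ)

section Charts

theorem affineToricMap_comp_chart {S T : AddSubmonoid M} (hS : S ∈ Δ) (hT : T ∈ Δ) (h : S ≤ T) :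
    affineToricMap k h ≫ chart k hΔ hS = chart k hΔ hT := by
  have := hasColimit_diagram k hΔ
  exact colimit.w (diagram k Δ) (homOfLE (show (⟨S, hS⟩ : ↥Δ) ≤ ⟨T, hT⟩ from h)).op

theorem affineToricMap_apply {S T U : AddSubmonoid M} (h : S ≤ T) (h' : T ≤ U)
    (x : affineToric k U) :
    affineToricMap k h (affineToricMap k h' x) = affineToricMap k (h.trans h') x := by
  rw [← Scheme.Hom.comp_apply, affineToricMap_comp]

theorem chart_affineToricMap_apply {S T : AddSubmonoid M} (hS : S ∈ Δ) (hT : T ∈ Δ) (h : S ≤ T)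
    (x : affineToric k T) : chart k hΔ hS (affineToricMap k h x) = chart k hΔ hT x := by
  rw [← Scheme.Hom.comp_apply, affineToricMap_comp_chart]

theorem isOpenImmersion_chart {S : AddSubmonoid M} (hS : S ∈ Δ) :
    IsOpenImmersion (chart k hΔ hS) := by
  have := isLocallyDirected_diagram k hΔ
  have : ∀ {S T : (↥Δ)ᵒᵖ} (f : S ⟶ T), IsOpenImmersion ((diagram k Δ).map f) :=
    isOpenImmersion_diagram_map k hΔ
  exact inferInstanceAs (IsOpenImmersion (colimit.ι (diagram k Δ) (op ⟨S, hS⟩)))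

/-- The open cover of `X_Δ` by its charts. -/
noncomputable def chartCover : (toricVariety k hΔ).OpenCover :=
  haveI := isLocallyDirected_diagram k hΔ
  haveI : ∀ {S T : (↥Δ)ᵒᵖ} (f : S ⟶ T), IsOpenImmersion ((diagram k Δ).map f) :=
    isOpenImmersion_diagram_map k hΔ
  Scheme.IsLocallyDirected.openCover (diagram k Δ)

theorem exists_chart_eq (x : toricVariety k hΔ) :
    ∃ (S : AddSubmonoid M) (hS : S ∈ Δ) (y : affineToric k S), chart k hΔ hS y = x := by
  have := isLocallyDirected_diagram k hΔ
  have : ∀ {S T : (↥Δ)ᵒᵖ} (f : S ⟶ T), IsOpenImmersion ((diagram k Δ).map f) :=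
    isOpenImmersion_diagram_map k hΔ
  obtain ⟨i, y, hy⟩ := Scheme.IsLocallyDirected.ι_jointly_surjective (diagram k Δ) x
  exact ⟨i.unop.1, i.unop.2, y, hy⟩

/-- Points are identified through some member containing `S` and `T`; it contains their sum, so the
charts meet only in `Spec k[S + T]`. -/
theorem exists_sup_of_chart_eq_chart {S T : AddSubmonoid M} (hS : S ∈ Δ) (hT : T ∈ Δ)
    {x : affineToric k S} {y : affineToric k T} (h : chart k hΔ hS x = chart k hΔ hT y) :
    ∃ z : affineToric k (S ⊔ T), affineToricMap k le_sup_left z = x ∧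
      affineToricMap k le_sup_right z = y := by
  have := isLocallyDirected_diagram k hΔ
  have : ∀ {S T : (↥Δ)ᵒᵖ} (f : S ⟶ T), IsOpenImmersion ((diagram k Δ).map f) :=
    isOpenImmersion_diagram_map k hΔ
  obtain ⟨U, f, g, z, rfl, rfl⟩ := (Scheme.IsLocallyDirected.ι_eq_ι_iff (diagram k Δ)).mp h
  have hle : S ⊔ T ≤ U.unop.1 := sup_le (leOfHom f.unop) (leOfHom g.unop)
  exact ⟨affineToricMap k hle z, affineToricMap_apply k _ _ _, affineToricMap_apply k _ _ _⟩

variable [Module.Free ℤ M] [Module.Finite ℤ M]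

theorem isIntegral_affineToric (S : AddSubmonoid M) : IsIntegral (affineToric k S) := by
  have := isDomain_addMonoidAlgebra k S
  infer_instance

theorem isIntegral_toricVariety : IsIntegral (toricVariety k hΔ) := by
  have hint (S : AddSubmonoid M) := isIntegral_affineToric k S
  have : ∀ i, IsReduced ((chartCover k hΔ).X i) := fun i =>
    inferInstanceAs (IsReduced (affineToric k i.unop.1))
  have : IsReduced (toricVariety k hΔ) := .of_openCover _ (chartCover k hΔ)
  have : IrreducibleSpace (toricVariety k hΔ) := by
    -- The torus `Spec k[M]` is a non-empty open subset of every irreducible chart, hence dense in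
    -- all of them.
    have hcl : closure (Set.range (chart k hΔ hΔ.top_mem)) = Set.univ := by
      refine Set.eq_univ_of_forall fun x => ?_
      obtain ⟨S, hS, y, rfl⟩ := exists_chart_eq k hΔ x
      have := isOpenImmersion_affineToricMap k (le_top : S ≤ ⊤)
        (isMonoidLocalization_of_le hΔ hS hΔ.top_mem le_top)
      have hd : Dense (Set.range (affineToricMap k (le_top : S ≤ ⊤))) :=
        (affineToricMap k _).isOpenEmbedding.isOpen_range.dense (Set.range_nonempty _)
      rw [← affineToricMap_comp_chart k hΔ hS hΔ.top_mem le_top]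
      have := image_closure_subset_closure_image (chart k hΔ hS).continuous
        (Set.mem_image_of_mem _ (hd y))
      rwa [← Set.range_comp] at this
    rw [irreducibleSpace_def, Set.top_eq_univ, ← hcl, ← Set.image_univ]
    exact ((IrreducibleSpace.isIrreducible_univ _).image _
      (chart k hΔ hΔ.top_mem).continuous.continuousOn).closure
  exact isIntegral_of_irreducibleSpace_of_isReduced _

end Charts

section Normalization

variable {hN : IsToricCollection (saturation '' Δ)}

theorem exists_isIntegrallyClosed_of_isOpenImmersion {Y : Scheme.{u}} {R : CommRingCat.{u}}
    [IsIntegrallyClosed R] (f : Spec R ⟶ Y) [IsOpenImmersion f] (x : Spec R) :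
    ∃ V : Y.Opens, f x ∈ V ∧ IsAffineOpen V ∧ IsIntegrallyClosed Γ(Y, V) := by
  refine ⟨f.opensRange, ⟨x, rfl⟩, isAffineOpen_opensRange f, ?_⟩
  exact .of_equiv ((Scheme.ΓSpecIso R).symm ≪≫ (asIso (f.appIso ⊤).inv) ≪≫
    Y.presheaf.mapIso (eqToIso (by simp)).op).commRingCatIsoToRingEquiv

theorem isNormalization_affineToricMap [Module.Free ℤ M] [Module.Finite ℤ M]
    {S : AddSubmonoid M} (hfg : S.FG)
    (hS : AddSubgroup.closure (S : Set M) = ⊤) :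
    IsNormalization (affineToricMap k (le_saturation S)) := by
  have hint (S : AddSubmonoid M) := isIntegral_affineToric k S
  have : IsIntegralHom (affineToricMap k (le_saturation S)) :=
    IsIntegralHom.SpecMap_iff.mpr (isIntegral_algebraInclusion_saturation k S)
  have hcl : AddSubgroup.closure (saturation S : Set M) = ⊤ :=
    closure_eq_top_of_le (le_saturation S) hS
  have := isOpenImmersion_affineToricMap k (le_top : saturation S ≤ ⊤)
    (isMonoidLocalization_top (saturation_fg hfg hS) hcl (le_refl _))
  have : IsOpenImmersion (affineToricMap k (le_top : saturation S ≤ ⊤) ≫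
      affineToricMap k (le_saturation S)) := by
    rw [affineToricMap_comp]
    exact isOpenImmersion_affineToricMap k _ (isMonoidLocalization_top hfg hS (le_refl _))
  refine isNormalization_of_isIntegralHom _ (affineToricMap k (le_top : saturation S ≤ ⊤)) 
    fun y => ?_
  have := isIntegrallyClosed_saturation k hfg hS
  exact exists_isIntegrallyClosed_of_isOpenImmersion (𝟙 (affineToric k (saturation S))) y

/-- The affine morphisms glue because an inclusion of saturations comes from an inclusion in `Δ`. In
particular saturation is injective on `Δ`, so the chosen preimages `σ T` involve no ambiguity. -/
theorem exists_hom_saturation (hN : IsToricCollection (saturation '' Δ)) :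
    ∃ ν : toricVariety k hN ⟶ toricVariety k hΔ, ∀ (S : AddSubmonoid M) (hS : S ∈ Δ),
      chart k hN (Set.mem_image_of_mem saturation hS) ≫ ν =
        affineToricMap k (le_saturation S) ≫ chart k hΔ hS := by
  have := hasColimit_diagram k hN
  choose σ hσ hσs using fun T : ↥(saturation '' Δ) => T.2
  have hle : ∀ T, σ T ≤ T.1 := fun T => (le_saturation _).trans (hσs T).le
  have hcomp : ∀ (T : ↥(saturation '' Δ)) (S : AddSubmonoid M) (hS : S ∈ Δ) (h : S ≤ T.1),
      S ≤ σ T → affineToricMap k h ≫ chart k hΔ hS =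
        affineToricMap k (hle T) ≫ chart k hΔ (hσ T) := by
    intro T S hS h h'
    rw [← affineToricMap_comp_chart k hΔ hS (hσ T) h', ← Category.assoc, affineToricMap_comp]
  refine ⟨colimit.desc (diagram k (saturation '' Δ)) ⟨_, ?_⟩, fun S hS => ?_⟩
  · refine ⟨fun T => affineToricMap k (hle T.unop) ≫ chart k hΔ (hσ T.unop), fun T T' f => ?_⟩
    have hf : T'.unop.1 ≤ T.unop.1 := leOfHom f.unop
    change affineToricMap k hf ≫ affineToricMap k (hle T'.unop) ≫ chart k hΔ (hσ T'.unop) =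
      (affineToricMap k (hle T.unop) ≫ chart k hΔ (hσ T.unop)) ≫ 𝟙 _
    rw [Category.comp_id, ← hcomp T.unop (σ T'.unop) (hσ _) ((hle _).trans hf)
      (hΔ.le_of_saturation_le (hσ _) (hσ _) (by rwa [hσs, hσs])), ← affineToricMap_comp k (hle _) hf,
      Category.assoc]
  · refine (colimit.ι_desc _ _).trans ?_
    exact (hcomp ⟨saturation S, Set.mem_image_of_mem _ hS⟩ S hS (le_saturation S)
      (hΔ.le_of_saturation_le hS (hσ _)
        (hσs ⟨saturation S, Set.mem_image_of_mem _ hS⟩).ge)).symm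

variable {k hΔ} {ν : toricVariety k hN ⟶ toricVariety k hΔ}

/-- Both charts are open immersions, so it suffices that the preimage of the chart of `S` is the
chart of its saturation as a set. -/
theorem isPullback_chart_saturation
    (hν : ∀ (S : AddSubmonoid M) (hS : S ∈ Δ), chart k hN (Set.mem_image_of_mem saturation hS) ≫ ν =
      affineToricMap k (le_saturation S) ≫ chart k hΔ hS)
    {S : AddSubmonoid M} (hS : S ∈ Δ) :
    IsPullback (affineToricMap k (le_saturation S))
      (chart k hN (Set.mem_image_of_mem saturation hS)) (chart k hΔ hS) ν := by
  have := isOpenImmersion_chart k hΔ hS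
  have := isOpenImmersion_chart k hN (Set.mem_image_of_mem saturation hS)
  refine IsOpenImmersion.isPullback _ _ _ _ (hν S hS) (le_antisymm ?_ ?_)
  · rintro y ⟨x, hx⟩
    obtain ⟨_, ⟨T, hT, rfl⟩, t, rfl⟩ := exists_chart_eq k hN y
    rw [← Scheme.Hom.comp_apply, hν T hT, Scheme.Hom.comp_apply] at hx
    -- The image point lies over the overlap, where `t^u` is invertible for some `u` with `S + T = T
    -- + ℕ(-u)`. The same `u` localizes `T^sat` to `T^sat + S^sat`, so the original point lies in
    -- the overlap upstairs.
    obtain ⟨z, -, hz⟩ := exists_sup_of_chart_eq_chart k hΔ hS hT hx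
    obtain ⟨u, hu, hTu⟩ := hΔ.sup_right S hS T hT
    have hsat := (hΔ.saturation_sup hT hu (sup_comm T S ▸ hTu)).2
    have ht : t ∈ Set.range (affineToricMap k (le_sup_left : saturation T ≤ _ ⊔ saturation S)) := by
      rw [range_affineToricMap k _ (le_saturation T hu) hsat]
      have : affineToricMap k (le_saturation T) t ∈
          Set.range (affineToricMap k (le_sup_right : T ≤ S ⊔ T)) := ⟨z, hz⟩
      rw [range_affineToricMap k _ hu hTu] at this
      change algebraInclusion k (le_saturation T) (AddMonoidAlgebra.single ⟨u, hu⟩ 1) ∉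
        t.asIdeal at this
      rwa [algebraInclusion_single] at this
    obtain ⟨t', rfl⟩ := ht
    have hST : saturation T ⊔ saturation S ∈ saturation '' Δ :=
      hN.sup_mem ⟨T, hT, rfl⟩ ⟨S, hS, rfl⟩
    refine ⟨affineToricMap k le_sup_right t', ?_⟩
    exact (chart_affineToricMap_apply k hN _ hST _ t').trans
      (chart_affineToricMap_apply k hN _ hST _ t').symm
  · rintro _ ⟨x, rfl⟩
    refine ⟨affineToricMap k (le_saturation S) x, ?_⟩
    rw [← Scheme.Hom.comp_apply, ← hν S hS]
    rfl

theorem isIntegralHom_of_chart_comp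
    (hν : ∀ (S : AddSubmonoid M) (hS : S ∈ Δ), chart k hN (Set.mem_image_of_mem saturation hS) ≫ ν =
      affineToricMap k (le_saturation S) ≫ chart k hΔ hS) :
    IsIntegralHom ν := by
  have := (HasAffineProperty.iff.mp IsIntegralHom.hasAffineProperty.{u}).1
  refine IsZariskiLocalAtTarget.of_openCover (P := @IsIntegralHom) (chartCover k hΔ) fun i => ?_
  have h := (isPullback_chart_saturation hν i.unop.2).flip
  have : IsIntegralHom (affineToricMap k (le_saturation i.unop.1)) :=
    IsIntegralHom.SpecMap_iff.mpr (isIntegral_algebraInclusion_saturation k _)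
  have := h.isoPullback_inv_snd
  change IsIntegralHom (pullback.snd ν (chart k hΔ i.unop.2))
  rw [← this]
  infer_instance

theorem isNormalization_of_chart_comp [Module.Free ℤ M] [Module.Finite ℤ M]
    (hν : ∀ (S : AddSubmonoid M) (hS : S ∈ Δ), chart k hN (Set.mem_image_of_mem saturation hS) ≫ ν =
      affineToricMap k (le_saturation S) ≫ chart k hΔ hS) :
    IsNormalization ν := by
  have hint (S : AddSubmonoid M) := isIntegral_affineToric k S
  have := isIntegral_toricVariety k hΔ
  have := isIntegral_toricVariety k hN
  have := isIntegralHom_of_chart_comp hν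
  have := isOpenImmersion_chart k hN hN.top_mem
  -- `M` is its own saturation, so `ν` carries torus to torus by the identity; the torus serves as
  -- the common open subscheme.
  have : IsOpenImmersion (chart k hN hN.top_mem ≫ ν) := by
    have hst : saturation (⊤ : AddSubmonoid M) = ⊤ := top_le_iff.mp (le_saturation ⊤)
    rw [← affineToricMap_comp_chart k hN (Set.mem_image_of_mem saturation hΔ.top_mem) hN.top_mem
      le_top, Category.assoc, hν ⊤ hΔ.top_mem, ← Category.assoc, affineToricMap_comp,
      affineToricMap_comp_chart k hΔ hΔ.top_mem hΔ.top_mem]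
    exact isOpenImmersion_chart k hΔ hΔ.top_mem
  refine isNormalization_of_isIntegralHom ν (chart k hN hN.top_mem) fun y => ?_
  obtain ⟨_, ⟨S, hS, rfl⟩, y, rfl⟩ := exists_chart_eq k hN y
  have := isOpenImmersion_chart k hN (Set.mem_image_of_mem saturation hS)
  have := isIntegrallyClosed_saturation k (hΔ.fg S hS) (hΔ.generates S hS)
  exact exists_isIntegrallyClosed_of_isOpenImmersion (chart k hN _) y

end Normalization

end ToricVarieties

/-- The collection `Δ'` is kept variable because the fan describes the saturated monoids as
`coneMonoid (dualCone S)`, equal to `saturation S` only by a theorem; the equality can then be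
substituted. -/
theorem exists_isNormalization_of_eq_image_saturation (k : Type u) [Field k] {M : Type u}
    [AddCommGroup M] [Module.Free ℤ M] [Module.Finite ℤ M] {Δ Δ' : Set (AddSubmonoid M)}
    (hΔ : IsToricCollection Δ) (hN : IsToricCollection Δ') (h : Δ' = saturation '' Δ) :
    ∃ ν : toricVariety k hN ⟶ toricVariety k hΔ, IsNormalization ν ∧
      ∀ (S T : AddSubmonoid M) (hS : S ∈ Δ) (hT : T ∈ Δ'), T = saturation S →
        (∃ hle : S ≤ T, chart k hN hT ≫ ν = affineToricMap k hle ≫ chart k hΔ hS) ∧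
        ∀ (m : ℕ) (s : Fin m → M) (s' s'' : Fin m → S), IsGeneratingChoice S s s' s'' →
          ∃ b : blowup (productIdeal k s' s'') ⟶ toricVariety k hN,
            IsPullback b (blowupMap (productIdeal k s' s'')) ν (chart k hΔ hS) := by
  subst h
  obtain ⟨ν, hν⟩ := exists_hom_saturation k hΔ hN
  refine ⟨ν, isNormalization_of_chart_comp hν, ?_⟩
  rintro S _ hS hT rfl
  refine ⟨⟨le_saturation S, hν S hS⟩, fun m s s' s'' h => ?_⟩
  obtain ⟨e, he⟩ := exists_affineToric_iso_blowup k h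
  exact ⟨e.inv ≫ chart k hN hT, (isPullback_chart_saturation hν hS).flip.of_iso e (.refl _)
    (.refl _) (.refl _) (by simp) (by simp [he]) (by simp) (by simp)⟩

end ToricBlowup

theorem mainTheorem2 (k : Type u) [Field k] (M : Type u) [AddCommGroup M] [Module.Free ℤ M]
    [Module.Finite ℤ M] :
    (∀ S : AddSubmonoid M, S.FG → AddSubgroup.closure (S : Set M) = ⊤ →
      IsNormalization (affineToricMap k (le_saturation S)) ∧
      (∃ (m : ℕ) (s : Fin m → M) (s' s'' : Fin m → S), IsGeneratingChoice S s s' s'') ∧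
      ∀ (m : ℕ) (s : Fin m → M) (s' s'' : Fin m → S), IsGeneratingChoice S s s' s'' →
        ∃ e : affineToric k (saturation S) ≅ blowup (productIdeal k s' s''),
          e.hom ≫ blowupMap (productIdeal k s' s'') = affineToricMap k (le_saturation S)) ∧
    (∀ (Δ : Set (AddSubmonoid M)) (hΔ : IsToricCollection Δ),
      IsFan (dualCone '' Δ) ∧
      ∃ (hN : IsToricCollection (coneMonoid '' (dualCone '' Δ)))
        (ν : toricVariety k hN ⟶ toricVariety k hΔ),
        IsNormalization ν ∧
        ∀ (S : AddSubmonoid M) (hS : S ∈ Δ),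
          (∃ hle : S ≤ coneMonoid (dualCone S),
            chart k hN (Set.mem_image_of_mem coneMonoid (Set.mem_image_of_mem dualCone hS)) ≫ ν =
              affineToricMap k hle ≫ chart k hΔ hS) ∧
          ∀ (m : ℕ) (s : Fin m → M) (s' s'' : Fin m → S), IsGeneratingChoice S s s' s'' →
            ∃ b : blowup (productIdeal k s' s'') ⟶ toricVariety k hN,
              IsPullback b (blowupMap (productIdeal k s' s'')) ν (chart k hΔ hS)) := by
  refine ⟨fun S hfg hS => ⟨isNormalization_affineToricMap k hfg hS,
    exists_isGeneratingChoice hfg hS,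
    fun m s s' s'' h => exists_affineToric_iso_blowup k h⟩, fun Δ hΔ => ?_⟩
  have h := image_coneMonoid_dualCone hΔ
  have hN : IsToricCollection (coneMonoid '' (dualCone '' Δ)) := h ▸ hΔ.image_saturation
  obtain ⟨ν, hν, hcharts⟩ := exists_isNormalization_of_eq_image_saturation k hΔ hN h
  exact ⟨isFan_image_dualCone hΔ, hN, ν, hν, fun S hS =>
    hcharts S _ hS _ (coneMonoid_dualCone (hΔ.fg S hS) (hΔ.generates S hS))⟩
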